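/- Let $\mathcal G$ be a finite tree with $N\ge 1$ edges $e_1,\dots,e_N$ and vertex set $\mathcal V=\{a_1,\dots,a_{N+1}\}$. The edge $e_j$ has length $\ell_j>0$ and is identified with $[0,\ell_j]$, with orientation recorded by $d_{kj}=1$ if $x=\ell_j$ corresponds to $a_k$, $d_{kj}=-1$ if $x=0$ corresponds to $a_k$, and $d_{kj}=0$ otherwise. The root $a_1$ is a vertex of degree one, and $e_1$ is the edge adjacent to it. Every edge is either a string ($j\in I_S$) or a beam ($j\in I_B$). For a vertex $a_k$ let $I(a_k)$, $I_S(a_k)$, $I_B(a_k)$ be the sets of indices of all edges, strings, beams adjacent to $a_k$. Let $\mathcal V_{int}$ be the set of vertices of degree at least two, and let $\mathcal V^S_{ext}$ (resp. $\mathcal V^B_{ext}$) be the set of vertices $a_k\ne a_1$ of degree one whose unique adjacent edge $e_{j_k}$ is a string (resp. a beam). For a function $f=(f^j)_j$ on the edges, $\partial_x^m f^j(a_k)$ denotes the value of $\partial_x^m f^j$ at the end of $[0,\ell_j]$ corresponding to $a_k$. Let $V$ be the space of all complex-valued $f\in\prod_{j\in I_S}H^1(0,\ell_j)\times\prod_{j\in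 I_B}H^2(0,\ell_j)$ such that $$f^1(a_1)=0;\qquad f^j(a_k)=f^l(a_k)\ \ (j,l\in I(a_k),\ a_k\in\mathcal V_{int});$$ $$\partial_xf^{j_k}(a_k)=0\ \ (a_k\in\mathcal V^B_{ext});\qquad \sum_{j\in I_B(a_k)}d_{kj}\,\partial_xf^j(a_k)=0\ \ (a_k\in\mathcal V_{int}).$$ Let $\mathcal H=V\times\prod_{j=1}^N L^2(0,\ell_j)$ with the energy inner product $$\langle (f_1,g_1),(f_2,g_2)\rangle_{\mathcal H}=\sum_{j\in I_S}\langle\partial_xf_1^j,\partial_xf_2^j\rangle_{L^2}+\sum_{j\in I_B}\langle\partial_x^2f_1^j,\partial_x^2f_2^j\rangle_{L^2}+\sum_{j=1}^N\langle g_1^j,g_2^j\rangle_{L^2}.$$ Let $\mathcal A$ be the operator on $\mathcal H$ whose domain $\mathcal D(\mathcal A)$ consists of all $(u,v)\in V\times V$ with $u^j\in H^2(0,\ell_j)$ for $j\in I_S$, $u^j\in H^4(0,\ell_j)$ for $j\in I_B$, and $$\partial_xu^{j_k}(a_k)=-d_{kj_k}v^{j_k}(a_k)\ \ (a_k\in\mathcal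 V^S_{ext});\qquad \partial_x^3u^{j_k}(a_k)=d_{kj_k}v^{j_k}(a_k)\ \ (a_k\in\mathcal V^B_{ext});$$ $$\partial_x^2u^1(a_1)=0\ \text{ if } e_1 \text{ is a beam};\qquad \partial_x^2u^j(a_k)=\partial_x^2u^l(a_k)\ \ (j,l\in I_B(a_k),\ a_k\in\mathcal V_{int});$$ $$\sum_{j\in I_S(a_k)}d_{kj}\,\partial_xu^j(a_k)-\sum_{j\in I_B(a_k)}d_{kj}\,\partial_x^3u^j(a_k)=0\ \ (a_k\in\mathcal V_{int}),$$ and which is given by $\mathcal A(u,v)=(v,w)$ with $w^j=\partial_x^2u^j$ for $j\in I_S$ and $w^j=-\partial_x^4u^j$ for $j\in I_B$. Then $\mathcal H$ is a Hilbert space, and $\mathcal A$ is the infinitesimal generator of a $C_0$-semigroup of contractions on $\mathcal H$. Consequently, for every $y_0\in\mathcal H$ the problem $\frac{dy}{dt}=\mathcal Ay$, $y(0)=y_0$, has a unique (mild) solution $y\in C([0,\infty),\mathcal H)$, that is, a unique continuous $y:[0,\infty)\to\mathcal H$ such that for all $t\ge0$ one has $\int_0^ty(s)\,ds\in\mathcal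 D(\mathcal A)$ and $y(t)-y_0=\mathcal A\int_0^ty(s)\,ds$. If moreover $y_0\in\mathcal D(\mathcal A)$, then $y\in C([0,\infty),\mathcal D(\mathcal A))\cap C^1([0,\infty),\mathcal H)$, where $\mathcal D(\mathcal A)$ carries the graph norm, and $y'(t)=\mathcal Ay(t)$ for all $t\ge0$. -/

import Mathlib

open MeasureTheory Set Topology Filter
open scoped ContDiff NNReal ComplexConjugate

noncomputable section
namespace StringBeam

/-- The complex Hilbert space `L²(0,ℓ)`. -/
abbrev L2I (ℓ : ℝ) : Type := Lp ℂ 2 (volume.restrict (Ioo (0 : ℝ) ℓ))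

/-- Test functions: smooth, with compact support contained in the open interval `(0,ℓ)`. -/
structure IsTest (ℓ : ℝ) (φ : ℝ → ℝ) : Prop where
  smooth : ContDiff ℝ ∞ φ
  compact : HasCompactSupport φ
  supp : tsupport φ ⊆ Ioo 0 ℓ

/-- `g` is the `k`-th weak derivative of `f` on `(0,ℓ)`. -/
def IsWeakDeriv {ℓ : ℝ} (k : ℕ) (f g : L2I ℓ) : Prop :=
  ∀ φ : ℝ → ℝ, IsTest ℓ φ →
    ∫ x in Ioo 0 ℓ, iteratedDeriv k φ x • f x = (-1) ^ k * ∫ x in Ioo 0 ℓ, φ x • g x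

lemma IsTest.deriv {ℓ : ℝ} {φ : ℝ → ℝ} (h : IsTest ℓ φ) : IsTest ℓ (deriv φ) where
  smooth := (contDiff_infty_iff_deriv.1 h.smooth).2
  compact := h.compact.deriv
  supp := tsupport_deriv_subset.trans h.supp

lemma IsTest.iteratedDeriv {ℓ : ℝ} {φ : ℝ → ℝ} (h : IsTest ℓ φ) (k : ℕ) :
    IsTest ℓ (iteratedDeriv k φ) := by
  induction k with
  | zero => simpa using h
  | succ k ih => rw [iteratedDeriv_succ]; exact ih.deriv

lemma L2I.integrable {ℓ : ℝ} (f : L2I ℓ) : Integrable f (volume.restrict (Ioo 0 ℓ)) :=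
  (Lp.memLp f).integrable (by norm_num)

lemma integrable_smul {ℓ : ℝ} {φ : ℝ → ℝ} (h : Continuous φ) (hc : HasCompactSupport φ)
    {f : ℝ → ℂ} (hf : Integrable f (volume.restrict (Ioo 0 ℓ))) :
    Integrable (fun x => φ x • f x) (volume.restrict (Ioo 0 ℓ)) := by
  obtain ⟨C, hC⟩ := hc.exists_bound_of_continuous h
  exact hf.bdd_smul C h.aestronglyMeasurable (Eventually.of_forall hC)

lemma IsTest.integrable_smul {ℓ : ℝ} {φ : ℝ → ℝ} (h : IsTest ℓ φ) (f : L2I ℓ) :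
    Integrable (fun x => φ x • f x) (volume.restrict (Ioo 0 ℓ)) :=
  StringBeam.integrable_smul h.smooth.continuous h.compact f.integrable

lemma ae_zero_of_test {ℓ : ℝ} {f : ℝ → ℂ} (hf : Integrable f (volume.restrict (Ioo 0 ℓ)))
    (h : ∀ φ : ℝ → ℝ, IsTest ℓ φ → ∫ x in Ioo 0 ℓ, φ x • f x = 0) :
    f =ᵐ[volume.restrict (Ioo 0 ℓ)] 0 := by
  have := isOpen_Ioo.ae_eq_zero_of_integral_contDiff_smul_eq_zero (U := Ioo 0 ℓ) (μ := volume)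
    (f := f) (IntegrableOn.locallyIntegrableOn hf) (by
      intro φ h1 h2 h3
      rw [← h φ ⟨h1, h2, h3⟩, setIntegral_eq_integral_of_forall_compl_eq_zero]
      intro x hx
      rw [image_eq_zero_of_notMem_tsupport (fun hh => hx (h3 hh)), zero_smul])
  rw [Filter.EventuallyEq, ae_restrict_iff' measurableSet_Ioo]
  exact this

lemma IsWeakDeriv.unique {ℓ : ℝ} {k : ℕ} {f g g' : L2I ℓ} (h : IsWeakDeriv k f g)
    (h' : IsWeakDeriv k f g') : g = g' := by
  have : (fun x => g x - g' x) =ᵐ[volume.restrict (Ioo 0 ℓ)] 0 := by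
    refine ae_zero_of_test (g.integrable.sub g'.integrable) fun φ hφ => ?_
    simp only [smul_sub]
    rw [integral_sub (hφ.integrable_smul g) (hφ.integrable_smul g')]
    have := (h φ hφ).symm.trans (h' φ hφ)
    rw [mul_right_inj' (by simp)] at this
    rw [this, sub_self]
  apply Lp.ext
  filter_upwards [this] with x hx
  exact sub_eq_zero.1 hx

lemma IsWeakDeriv.add {ℓ : ℝ} {k : ℕ} {f g f' g' : L2I ℓ} (h : IsWeakDeriv k f g)
    (h' : IsWeakDeriv k f' g') : IsWeakDeriv k (f + f') (g + g') := by
  have key : ∀ (φ : ℝ → ℝ) (u v : L2I ℓ), IsTest ℓ φ → ∫ x in Ioo 0 ℓ, φ x • (u + v : L2I ℓ) x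
      = (∫ x in Ioo 0 ℓ, φ x • u x) + ∫ x in Ioo 0 ℓ, φ x • v x := by
    intro φ u v hφ
    rw [← integral_add (hφ.integrable_smul u) (hφ.integrable_smul v)]
    apply integral_congr_ae
    filter_upwards [Lp.coeFn_add u v] with x hx
    rw [hx, Pi.add_apply, smul_add]
  intro φ hφ
  rw [key _ _ _ (hφ.iteratedDeriv k), key _ _ _ hφ, h φ hφ, h' φ hφ, mul_add]

lemma IsWeakDeriv.smul {ℓ : ℝ} {k : ℕ} {f g : L2I ℓ} (c : ℂ) (h : IsWeakDeriv k f g) :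
    IsWeakDeriv k (c • f) (c • g) := by
  have key : ∀ (φ : ℝ → ℝ) (u : L2I ℓ), ∫ x in Ioo 0 ℓ, φ x • (c • u : L2I ℓ) x
      = c * (∫ x in Ioo 0 ℓ, φ x • u x) := by
    intro φ u
    rw [← smul_eq_mul, ← integral_smul]
    apply integral_congr_ae
    filter_upwards [Lp.coeFn_smul c u] with x hx
    rw [hx, Pi.smul_apply, smul_comm]
  intro φ hφ
  rw [key, key, h φ hφ]; ring

lemma IsWeakDeriv.of_add {ℓ : ℝ} {j k : ℕ} {f g h : L2I ℓ} (hg : IsWeakDeriv k f g)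
    (hh : IsWeakDeriv (k + j) f h) : IsWeakDeriv j g h := by
  intro φ hφ
  have h1 := hg _ (hφ.iteratedDeriv j)
  have h2 := hh φ hφ
  have : iteratedDeriv k (iteratedDeriv j φ) = iteratedDeriv (k + j) φ := by
    simp only [iteratedDeriv_eq_iterate, Function.iterate_add_apply]
  rw [this, h2, pow_add, mul_assoc] at h1
  rw [mul_right_inj' (by simp)] at h1
  exact h1.symm

/-- The Sobolev space `H^m(0,ℓ)`: all weak derivatives up to order `m` exist in `L²(0,ℓ)`. -/
def Sobolev (ℓ : ℝ) (m : ℕ) : Submodule ℂ (L2I ℓ) where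
  carrier := {f | ∀ k ≤ m, ∃ g, IsWeakDeriv k f g}
  add_mem' := fun ha hb k hk => by
    obtain ⟨g, hg⟩ := ha k hk
    obtain ⟨g', hg'⟩ := hb k hk
    exact ⟨_, hg.add hg'⟩
  zero_mem' := fun k _ => ⟨0, (fun φ hφ => by
    have : ∀ ψ : ℝ → ℝ, ∫ x in Ioo 0 ℓ, ψ x • (0 : L2I ℓ) x = 0 := fun ψ => by
      rw [← integral_zero ℝ ℂ (μ := volume.restrict (Ioo 0 ℓ))]
      apply integral_congr_ae
      filter_upwards [Lp.coeFn_zero ℂ 2 (volume.restrict (Ioo 0 ℓ))] with x hx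
      rw [hx]; simp
    rw [this, this, mul_zero] : IsWeakDeriv k (0 : L2I ℓ) 0)⟩
  smul_mem' := fun c f hf k hk => by
    obtain ⟨g, hg⟩ := hf k hk
    exact ⟨_, hg.smul c⟩

open Classical in
/-- The `k`-th weak derivative (unique when it exists; used only where it exists). -/
def weakDeriv {ℓ : ℝ} (k : ℕ) (f : L2I ℓ) : L2I ℓ :=
  if h : ∃ g, IsWeakDeriv k f g then h.choose else 0

lemma IsWeakDeriv.eq {ℓ : ℝ} {k : ℕ} {f g : L2I ℓ} (h : IsWeakDeriv k f g) :
    weakDeriv k f = g := by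
  have h' : ∃ g, IsWeakDeriv k f g := ⟨g, h⟩
  rw [weakDeriv, dif_pos h']
  exact h'.choose_spec.unique h

lemma Sobolev.spec {ℓ : ℝ} {m k : ℕ} {f : L2I ℓ} (h : f ∈ Sobolev ℓ m) (hk : k ≤ m) :
    IsWeakDeriv k f (weakDeriv k f) := by
  obtain ⟨g, hg⟩ := h k hk
  rwa [hg.eq]

lemma Sobolev.weakDeriv_add {ℓ : ℝ} {m k : ℕ} {f g : L2I ℓ} (hf : f ∈ Sobolev ℓ m)
    (hg : g ∈ Sobolev ℓ m) (hk : k ≤ m) : weakDeriv k (f + g) = weakDeriv k f + weakDeriv k g :=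
  ((Sobolev.spec hf hk).add (Sobolev.spec hg hk)).eq

lemma Sobolev.weakDeriv_smul {ℓ : ℝ} {m k : ℕ} {f : L2I ℓ} (hf : f ∈ Sobolev ℓ m) (c : ℂ)
    (hk : k ≤ m) : weakDeriv k (c • f) = c • weakDeriv k f :=
  ((Sobolev.spec hf hk).smul c).eq

/-- The primitive of `g` that vanishes at `0`. -/
def prim (g : ℝ → ℂ) (x : ℝ) : ℂ := ∫ t in 0..x, g t

lemma prim_eq {ℓ : ℝ} {g : ℝ → ℂ} {x : ℝ} (hx : x ∈ Ioo 0 ℓ) :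
    prim g x = ∫ t in Ioo 0 ℓ, (if t < x then g t else 0) := by
  rw [prim, intervalIntegral.integral_of_le hx.1.le, integral_Ioc_eq_integral_Ioo]
  have : (fun t => if t < x then g t else 0) = (Iio x).indicator g := by
    ext t; simp [indicator]
  rw [this, setIntegral_indicator measurableSet_Iio]
  congr 2
  ext t
  simp only [mem_inter_iff, mem_Ioo, mem_Iio]
  constructor
  · rintro ⟨h1, h2⟩; exact ⟨⟨h1, h2.trans hx.2⟩, h2⟩
  · rintro ⟨⟨h1, _⟩, h2⟩; exact ⟨h1, h2⟩

lemma prim_continuousOn {ℓ : ℝ} (hℓ : 0 < ℓ) {g : ℝ → ℂ} (hg : Integrable g (volume.restrict (Ioo 0 ℓ))) :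
    ContinuousOn (prim g) (Icc 0 ℓ) := by
  have := intervalIntegral.continuousOn_primitive_interval (μ := volume) (f := g) (a := 0) (b := ℓ)
  rw [uIcc_of_le hℓ.le] at this
  apply this
  rw [integrableOn_Icc_iff_integrableOn_Ioo]
  exact hg

lemma prim_test {ℓ : ℝ} {g : ℝ → ℂ} (hg : Integrable g (volume.restrict (Ioo 0 ℓ)))
    {φ : ℝ → ℝ} (hφ : IsTest ℓ φ) :
    ∫ x in Ioo 0 ℓ, deriv φ x • prim g x = - ∫ x in Ioo 0 ℓ, φ x • g x := by
  have e1 : ∫ x in Ioo 0 ℓ, deriv φ x • prim g x =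
      ∫ x in Ioo 0 ℓ, ∫ t in Ioo 0 ℓ, (if t < x then deriv φ x • g t else 0) := by
    apply setIntegral_congr_fun measurableSet_Ioo
    intro x hx
    simp only
    rw [prim_eq hx, ← integral_smul]
    congr 1
    ext t
    split_ifs <;> simp
  have hi : Integrable (Function.uncurry fun x t => (if t < x then deriv φ x • g t else 0))
      ((volume.restrict (Ioo 0 ℓ)).prod (volume.restrict (Ioo 0 ℓ))) := by
    have h1 : Integrable (deriv φ) (volume.restrict (Ioo 0 ℓ)) :=
      (hφ.deriv.smooth.continuous.integrable_of_hasCompactSupport hφ.deriv.compact).restrict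
    have h2 := (Integrable.smul_prod h1 hg).indicator
      (s := {p : ℝ × ℝ | p.2 < p.1}) (measurableSet_lt measurable_snd measurable_fst)
    refine h2.congr (Eventually.of_forall fun p => ?_)
    simp [indicator, Function.uncurry]
  rw [e1, integral_integral_swap hi, ← integral_neg]
  apply setIntegral_congr_fun measurableSet_Ioo
  intro t ht
  simp only
  have : (fun x => if t < x then deriv φ x • g t else 0) =
      (Ioi t).indicator (fun x => deriv φ x • g t) := by
    ext x; simp [indicator]
  rw [this, setIntegral_indicator measurableSet_Ioi, integral_smul_const, ← neg_smul]
  congr 1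
  have h3 : Ioo 0 ℓ ∩ Ioi t = Ioo t ℓ := by
    ext x
    simp only [mem_inter_iff, mem_Ioo, mem_Ioi]
    constructor
    · rintro ⟨⟨_, h1⟩, h2⟩; exact ⟨h2, h1⟩
    · rintro ⟨h1, h2⟩; exact ⟨⟨ht.1.trans h1, h2⟩, h1⟩
  rw [h3, ← integral_Ioc_eq_integral_Ioo, ← intervalIntegral.integral_of_le ht.2.le,
    intervalIntegral.integral_deriv_eq_sub]
  · rw [image_eq_zero_of_notMem_tsupport (fun hh => lt_irrefl _ (hφ.supp hh).2), zero_sub]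
  · intro x _; exact (hφ.smooth.differentiable (by simp)).differentiableAt
  · exact hφ.deriv.smooth.continuous.intervalIntegrable _ _

/-- A function with vanishing weak derivative is almost everywhere constant. -/
lemma const_of_test {ℓ : ℝ} (hℓ : 0 < ℓ) {f : ℝ → ℂ}
    (hf : Integrable f (volume.restrict (Ioo 0 ℓ)))
    (h : ∀ φ : ℝ → ℝ, IsTest ℓ φ → ∫ x in Ioo 0 ℓ, deriv φ x • f x = 0) :
    ∃ c : ℂ, f =ᵐ[volume.restrict (Ioo 0 ℓ)] fun _ => c := by
  obtain ⟨η, hη, hη1⟩ : ∃ η : ℝ → ℝ, IsTest ℓ η ∧ ∫ x in Ioo 0 ℓ, η x = 1 := by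
    let b : ContDiffBump (ℓ / 2) := ⟨ℓ / 8, ℓ / 4, by positivity, by linarith⟩
    refine ⟨b.normed volume, ⟨b.contDiff_normed, b.hasCompactSupport_normed, ?_⟩, ?_⟩
    · rw [b.tsupport_normed_eq, Real.closedBall_eq_Icc]
      intro x hx
      have h1 : ℓ / 2 - ℓ / 4 ≤ x := hx.1
      have h2 : x ≤ ℓ / 2 + ℓ / 4 := hx.2
      constructor <;> linarith
    · rw [setIntegral_eq_integral_of_forall_compl_eq_zero, b.integral_normed]
      intro x hx
      apply image_eq_zero_of_notMem_tsupport
      rw [b.tsupport_normed_eq, Real.closedBall_eq_Icc]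
      intro hx'
      have h1 : ℓ / 2 - ℓ / 4 ≤ x := hx'.1
      have h2 : x ≤ ℓ / 2 + ℓ / 4 := hx'.2
      exact hx ⟨by linarith, by linarith⟩
  refine ⟨∫ x in Ioo 0 ℓ, η x • f x, ?_⟩
  have := ae_zero_of_test (f := fun x => f x - ∫ x in Ioo 0 ℓ, η x • f x)
    (hf.sub (integrable_const _)) ?_
  · filter_upwards [this] with x hx
    exact sub_eq_zero.1 hx
  intro φ hφ
  have hiφ : Integrable φ := hφ.smooth.continuous.integrable_of_hasCompactSupport hφ.compact
  have hiη : Integrable η := hη.smooth.continuous.integrable_of_hasCompactSupport hη.compact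
  set I : ℝ := ∫ x in Ioo 0 ℓ, φ x with hI
  set ψ : ℝ → ℝ := fun x => φ x - I * η x with hψ
  have hψc : Continuous ψ := hφ.smooth.continuous.sub (continuous_const.mul hη.smooth.continuous)
  set Ψ : ℝ → ℝ := fun x => ∫ t in 0..x, ψ t with hΨ
  have hd : ∀ x, HasDerivAt Ψ (ψ x) x := fun x =>
    intervalIntegral.integral_hasDerivAt_right (hψc.intervalIntegrable _ _)
      (hψc.stronglyMeasurableAtFilter _ _) hψc.continuousAt
  have hdΨ : deriv Ψ = ψ := funext fun x => (hd x).deriv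
  -- ψ vanishes off a compact subinterval
  obtain ⟨a, b, ha, hab, hb, hsub⟩ : ∃ a b : ℝ, 0 < a ∧ a ≤ b ∧ b < ℓ ∧ ∀ x, x ∉ Icc a b → ψ x = 0 := by
    have hK : IsCompact (tsupport φ ∪ tsupport η) := hφ.compact.isCompact.union hη.compact.isCompact
    have hne : (tsupport φ ∪ tsupport η).Nonempty := by
      by_contra hcon
      rw [not_nonempty_iff_eq_empty, union_empty_iff, tsupport_eq_empty_iff,
        tsupport_eq_empty_iff] at hcon
      rw [hcon.2] at hη1
      simp at hη1
    have hs : tsupport φ ∪ tsupport η ⊆ Ioo 0 ℓ := union_subset hφ.supp hη.supp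
    have m1 := hs (hK.sInf_mem hne)
    have m2 := hs (hK.sSup_mem hne)
    refine ⟨_, _, m1.1, csInf_le_csSup hne hK.bddBelow hK.bddAbove, m2.2, fun x hx => ?_⟩
    have hx' : x ∉ tsupport φ ∪ tsupport η := fun hh =>
      hx ⟨csInf_le hK.bddBelow hh, le_csSup hK.bddAbove hh⟩
    rw [mem_union, not_or] at hx'
    simp [hψ, image_eq_zero_of_notMem_tsupport hx'.1, image_eq_zero_of_notMem_tsupport hx'.2]
  have hψI : ∫ t in 0..ℓ, ψ t = 0 := by
    rw [intervalIntegral.integral_of_le hℓ.le, integral_Ioc_eq_integral_Ioo]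
    simp only [hψ]
    rw [integral_sub hiφ.integrableOn (hiη.const_mul I).integrableOn, integral_const_mul, hη1]
    simp [hI]
  have hΨ0 : ∀ x, x ∉ Icc a b → Ψ x = 0 := by
    intro x hx
    rw [mem_Icc, not_and_or, not_le, not_le] at hx
    rcases hx with hx | hx
    · simp only [hΨ]
      rw [intervalIntegral.integral_congr (g := fun _ => (0 : ℝ)), intervalIntegral.integral_zero]
      intro t ht
      apply hsub
      intro hh
      have : t ≤ max 0 x := ht.2
      have h2 : max 0 x < a := max_lt ha hx
      linarith [hh.1]
    · have : Ψ x = (∫ t in 0..ℓ, ψ t) + ∫ t in ℓ..x, ψ t :=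
        (intervalIntegral.integral_add_adjacent_intervals (hψc.intervalIntegrable _ _)
          (hψc.intervalIntegrable _ _)).symm
      rw [this, hψI, zero_add, intervalIntegral.integral_congr (g := fun _ => (0 : ℝ)),
        intervalIntegral.integral_zero]
      intro t ht
      apply hsub
      intro hh
      have : min ℓ x ≤ t := ht.1
      have h2 : b < min ℓ x := lt_min hb hx
      linarith [hh.2]
  have hts : tsupport Ψ ⊆ Icc a b := by
    apply closure_minimal _ isClosed_Icc
    intro x hx
    by_contra hh
    exact hx (hΨ0 x hh)
  have hΨt : IsTest ℓ Ψ := by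
    refine ⟨?_, isCompact_Icc.of_isClosed_subset (isClosed_tsupport _) hts,
      hts.trans (Icc_subset_Ioo ha hb)⟩
    rw [contDiff_infty_iff_deriv]
    refine ⟨fun x => (hd x).differentiableAt, ?_⟩
    rw [hdΨ]
    exact hφ.smooth.sub (contDiff_const.mul hη.smooth)
  have hz := h Ψ hΨt
  rw [hdΨ] at hz
  have i1 := integrable_smul hφ.smooth.continuous hφ.compact hf
  have i2 := integrable_smul hη.smooth.continuous hη.compact hf
  have e1 : ∫ x in Ioo 0 ℓ, ψ x • f x =
      (∫ x in Ioo 0 ℓ, φ x • f x) - I * ∫ x in Ioo 0 ℓ, η x • f x := by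
    rw [← integral_const_mul, ← integral_sub i1 (i2.const_mul _)]
    congr 1
    ext x
    simp [hψ]; ring
  rw [e1] at hz
  simp only [smul_sub]
  rw [integral_sub i1 (hiφ.restrict.smul_const _), integral_smul_const]
  simpa [← hI] using hz

/-- `F` is a representative of the class `f` that is continuous on `[0,ℓ]`. -/
def IsContRep {ℓ : ℝ} (f : L2I ℓ) (F : ℝ → ℂ) : Prop :=
  ContinuousOn F (Icc 0 ℓ) ∧ f =ᵐ[volume.restrict (Ioo 0 ℓ)] F

open Classical in
/-- The value at `x ∈ [0,ℓ]` of the continuous representative of `f` (it exists for `f ∈ H¹(0,ℓ)`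
and its values on `[0,ℓ]` are unique, see the lemmas below). -/
def trace {ℓ : ℝ} (f : L2I ℓ) (x : ℝ) : ℂ :=
  if h : ∃ F : ℝ → ℂ, IsContRep f F then h.choose x else 0

lemma IsContRep.eqOn {ℓ : ℝ} (hℓ : 0 < ℓ) {f : L2I ℓ} {F G : ℝ → ℂ} (hF : IsContRep f F)
    (hG : IsContRep f G) : EqOn F G (Icc 0 ℓ) := by
  have h1 : EqOn F G (Ioo 0 ℓ) :=
    Measure.eqOn_open_of_ae_eq (hF.2.symm.trans hG.2) isOpen_Ioo
      (hF.1.mono Ioo_subset_Icc_self) (hG.1.mono Ioo_subset_Icc_self)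
  exact h1.of_subset_closure hF.1 hG.1 Ioo_subset_Icc_self (by rw [closure_Ioo hℓ.ne])

lemma IsContRep.trace_eq {ℓ : ℝ} (hℓ : 0 < ℓ) {f : L2I ℓ} {F : ℝ → ℂ} (hF : IsContRep f F)
    {x : ℝ} (hx : x ∈ Icc 0 ℓ) : trace f x = F x := by
  have h : ∃ F : ℝ → ℂ, IsContRep f F := ⟨F, hF⟩
  rw [trace, dif_pos h]
  exact h.choose_spec.eqOn hℓ hF hx

lemma IsWeakDeriv.exists_contRep {ℓ : ℝ} (hℓ : 0 < ℓ) {f g : L2I ℓ} (h : IsWeakDeriv 1 f g) :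
    ∃ c : ℂ, IsContRep f (fun x => c + prim g x) := by
  have hp := prim_continuousOn hℓ g.integrable
  have hpi : Integrable (prim g) (volume.restrict (Ioo 0 ℓ)) :=
    (hp.integrableOn_Icc).mono_set Ioo_subset_Icc_self
  obtain ⟨c, hc⟩ := const_of_test hℓ (f.integrable.sub hpi) (by
    intro φ hφ
    simp only [Pi.sub_apply, smul_sub]
    have i2 := StringBeam.integrable_smul hφ.deriv.smooth.continuous hφ.deriv.compact hpi
    rw [integral_sub (hφ.deriv.integrable_smul f) i2, prim_test g.integrable hφ]
    have := h φ hφ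
    rw [iteratedDeriv_one] at this
    rw [this]; simp)
  refine ⟨c, continuousOn_const.add hp, ?_⟩
  filter_upwards [hc] with x hx
  rw [← hx]; simp

lemma IsContRep.add {ℓ : ℝ} {f g : L2I ℓ} {F G : ℝ → ℂ} (hF : IsContRep f F)
    (hG : IsContRep g G) : IsContRep (f + g) (F + G) :=
  ⟨hF.1.add hG.1, (Lp.coeFn_add f g).trans (hF.2.add hG.2)⟩

lemma IsContRep.smul {ℓ : ℝ} {f : L2I ℓ} {F : ℝ → ℂ} (c : ℂ) (hF : IsContRep f F) :
    IsContRep (c • f) (c • F) :=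
  ⟨hF.1.const_smul c, (Lp.coeFn_smul c f).trans (hF.2.const_smul c)⟩

lemma Sobolev.contRep {ℓ : ℝ} (hℓ : 0 < ℓ) {m k : ℕ} {f : L2I ℓ} (hf : f ∈ Sobolev ℓ m)
    (hk : k + 1 ≤ m) : ∃ F, IsContRep (weakDeriv k f) F := by
  obtain ⟨c, hc⟩ := ((Sobolev.spec hf (by omega : k ≤ m)).of_add (Sobolev.spec hf hk)).exists_contRep hℓ
  exact ⟨_, hc⟩

lemma Sobolev.trace_add {ℓ : ℝ} (hℓ : 0 < ℓ) {m k : ℕ} {f g : L2I ℓ} (hf : f ∈ Sobolev ℓ m)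
    (hg : g ∈ Sobolev ℓ m) (hk : k + 1 ≤ m) {x : ℝ} (hx : x ∈ Icc 0 ℓ) :
    trace (weakDeriv k (f + g)) x = trace (weakDeriv k f) x + trace (weakDeriv k g) x := by
  obtain ⟨F, hF⟩ := Sobolev.contRep hℓ hf hk
  obtain ⟨G, hG⟩ := Sobolev.contRep hℓ hg hk
  rw [Sobolev.weakDeriv_add hf hg (by omega), (hF.add hG).trace_eq hℓ hx, hF.trace_eq hℓ hx,
    hG.trace_eq hℓ hx, Pi.add_apply]

lemma Sobolev.trace_smul {ℓ : ℝ} (hℓ : 0 < ℓ) {m k : ℕ} {f : L2I ℓ} (hf : f ∈ Sobolev ℓ m)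
    (c : ℂ) (hk : k + 1 ≤ m) {x : ℝ} (hx : x ∈ Icc 0 ℓ) :
    trace (weakDeriv k (c • f)) x = c * trace (weakDeriv k f) x := by
  obtain ⟨F, hF⟩ := Sobolev.contRep hℓ hf hk
  rw [Sobolev.weakDeriv_smul hf c (by omega), (hF.smul c).trace_eq hℓ hx, hF.trace_eq hℓ hx,
    Pi.smul_apply, smul_eq_mul]

lemma weakDeriv_zero {ℓ : ℝ} (f : L2I ℓ) : weakDeriv 0 f = f :=
  IsWeakDeriv.eq fun φ _ => by simp

/-- Every edge is a string or an Euler-Bernoulli beam. -/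
inductive Material
  | string
  | beam

/-- The order of the Sobolev space (and of the derivative in the energy) that belongs to an edge. -/
def Material.order : Material → ℕ
  | .string => 1
  | .beam => 2

lemma Material.order_pos (m : Material) : 1 ≤ m.order := by cases m <;> simp [Material.order]

/-- A tree-shaped network of strings and beams, with vertex set `V` and edge set `E`.
The edge `e` is identified with the interval `[0, length e]` by a parametrization that sends `0` to
the vertex `init e` and `length e` to the vertex `term e`. The root is a vertex of degree one. -/
structure Network (V E : Type*) where
  init : E → V
  term : E → V
  init_ne_term : ∀ e, init e ≠ term e
  ends_injective : Function.Injective fun e => s(init e, term e)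
  isTree : (SimpleGraph.fromEdgeSet (range fun e => s(init e, term e))).IsTree
  length : E → ℝ
  length_pos : ∀ e, 0 < length e
  kind : E → Material
  root : V
  root_exterior : ∃! e, init e = root ∨ term e = root

namespace Network

variable {V E : Type*} (T : Network V E)

/-- The set `I(a)` of edges adjacent to the vertex `a`. -/
def incident (a : V) : Set E := {e | T.init e = a ∨ T.term e = a}

/-- Exterior vertices: exactly one adjacent edge. -/
def IsExterior (a : V) : Prop := ∃! e, e ∈ T.incident a

/-- Interior vertices: at least two adjacent edges. -/
def IsInterior (a : V) : Prop := (T.incident a).Nontrivial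

open Classical in
/-- The incidence matrix: `1` if `e` ends at `a`, `-1` if `e` starts at `a`, `0` otherwise. -/
def d (a : V) (e : E) : ℂ := if T.term e = a then 1 else if T.init e = a then -1 else 0

open Classical in
/-- The coordinate in `{0, length e}` of the vertex `a` on an adjacent edge `e`. -/
def coord (a : V) (e : E) : ℝ := if T.term e = a then T.length e else 0

lemma coord_mem (a : V) (e : E) : T.coord a e ∈ Icc 0 (T.length e) := by
  have := T.length_pos e
  rw [coord]; split_ifs <;> constructor <;> linarith

/-- The product over all edges of the spaces `L²(0, length e)`. -/
abbrev L2 : Type _ := (e : E) → L2I (T.length e)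

/-- The value at the vertex `a` of the `k`-th derivative of `f` along the adjacent edge `e`. -/
def nodeVal (k : ℕ) (f : T.L2) (e : E) (a : V) : ℂ := trace (weakDeriv k (f e)) (T.coord a e)

variable {T}

lemma nodeVal_add {m k : ℕ} {f g : T.L2} {e : E} (hf : f e ∈ Sobolev (T.length e) m)
    (hg : g e ∈ Sobolev (T.length e) m) (hk : k + 1 ≤ m) (a : V) :
    T.nodeVal k (f + g) e a = T.nodeVal k f e a + T.nodeVal k g e a :=
  Sobolev.trace_add (T.length_pos e) hf hg hk (T.coord_mem a e)

lemma nodeVal_smul {m k : ℕ} {f : T.L2} {e : E} (hf : f e ∈ Sobolev (T.length e) m) (c : ℂ)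
    (hk : k + 1 ≤ m) (a : V) :
    T.nodeVal k (c • f) e a = c * T.nodeVal k f e a :=
  Sobolev.trace_smul (T.length_pos e) hf c hk (T.coord_mem a e)

variable (T)

lemma Sobolev_zero {ℓ : ℝ} {m : ℕ} {k : ℕ} (hℓ : 0 < ℓ) {x : ℝ} (hx : x ∈ Icc 0 ℓ)
    (hk : k + 1 ≤ m) : trace (weakDeriv k (0 : L2I ℓ)) x = 0 := by
  simpa using Sobolev.trace_smul hℓ (Sobolev ℓ m).zero_mem 0 hk hx

lemma nodeVal_zero (k : ℕ) (e : E) (a : V) : T.nodeVal k 0 e a = 0 :=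
  Sobolev_zero (m := k + 1) (T.length_pos e) (T.coord_mem a e) le_rfl

lemma coord_term (e : E) : T.coord (T.term e) e = T.length e := by simp [coord]
lemma coord_init (e : E) : T.coord (T.init e) e = 0 := by
  simp [coord, (T.init_ne_term e).symm]

variable [Fintype E]

open Classical in
/-- The strings, respectively beams, adjacent to the vertex `a`. -/
def edgesAt (m : Material) (a : V) : Finset E := {e | e ∈ T.incident a ∧ T.kind e = m}

lemma mem_edgesAt {m : Material} {a : V} {e : E} :
    e ∈ T.edgesAt m a ↔ e ∈ T.incident a ∧ T.kind e = m := by simp [edgesAt]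

/-- The regularity, boundary and transmission conditions that define the space of displacements. -/
structure InV (f : T.L2) : Prop where
  regular : ∀ e, f e ∈ Sobolev (T.length e) (T.kind e).order
  root : ∀ e ∈ T.incident T.root, T.nodeVal 0 f e T.root = 0
  continuous : ∀ a, T.IsInterior a → ∀ e ∈ T.incident a, ∀ e' ∈ T.incident a,
    T.nodeVal 0 f e a = T.nodeVal 0 f e' a
  clamped : ∀ a, T.IsExterior a → a ≠ T.root → ∀ e ∈ T.incident a, T.kind e = .beam →
    T.nodeVal 1 f e a = 0
  balance : ∀ a, T.IsInterior a → ∑ e ∈ T.edgesAt .beam a, T.d a e * T.nodeVal 1 f e a = 0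

lemma InV.regular_beam {T : Network V E} {f : T.L2} (hf : T.InV f) {e : E}
    (he : T.kind e = .beam) : f e ∈ Sobolev (T.length e) 2 := by
  have := hf.regular e
  rwa [he] at this

/-- The space `V` of admissible displacements. -/
def VSpace : Submodule ℂ T.L2 where
  carrier := {f | T.InV f}
  zero_mem' := by
    refine ⟨fun e => zero_mem _, ?_, ?_, ?_, ?_⟩ <;> simp [nodeVal_zero]
  add_mem' := by
    intro f g hf hg
    refine ⟨fun e => add_mem (hf.regular e) (hg.regular e), ?_, ?_, ?_, ?_⟩
    · intro e he
      rw [nodeVal_add (hf.regular e) (hg.regular e) (T.kind e).order_pos, hf.root e he,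
        hg.root e he, add_zero]
    · intro a ha e he e' he'
      rw [nodeVal_add (hf.regular e) (hg.regular e) (T.kind e).order_pos,
        nodeVal_add (hf.regular e') (hg.regular e') (T.kind e').order_pos,
        hf.continuous a ha e he e' he', hg.continuous a ha e he e' he']
    · intro a ha har e he hb
      rw [nodeVal_add (hf.regular_beam hb) (hg.regular_beam hb) le_rfl,
        hf.clamped a ha har e he hb, hg.clamped a ha har e he hb, add_zero]
    · intro a ha
      refine Eq.trans ?_ ((congrArg₂ (· + ·) (hf.balance a ha) (hg.balance a ha)).trans
        (add_zero 0))
      simp only [← Finset.sum_add_distrib]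
      refine Finset.sum_congr rfl fun e he => ?_
      have hb := (T.mem_edgesAt.1 he).2
      rw [nodeVal_add (hf.regular_beam hb) (hg.regular_beam hb) le_rfl, mul_add]
  smul_mem' := by
    intro c f hf
    refine ⟨fun e => Submodule.smul_mem _ c (hf.regular e), ?_, ?_, ?_, ?_⟩
    · intro e he
      rw [nodeVal_smul (hf.regular e) c (T.kind e).order_pos, hf.root e he, mul_zero]
    · intro a ha e he e' he'
      rw [nodeVal_smul (hf.regular e) c (T.kind e).order_pos,
        nodeVal_smul (hf.regular e') c (T.kind e').order_pos,
        hf.continuous a ha e he e' he']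
    · intro a ha har e he hb
      rw [nodeVal_smul (hf.regular_beam hb) c le_rfl, hf.clamped a ha har e he hb, mul_zero]
    · intro a ha
      rw [← mul_zero c, ← hf.balance a ha, Finset.mul_sum]
      refine Finset.sum_congr rfl fun e he => ?_
      have hb := (T.mem_edgesAt.1 he).2
      rw [nodeVal_smul (hf.regular_beam hb) c le_rfl]
      ring

/-- The energy space `H = V × ∏ L²(0, length e)`; its norm, defined below, is the energy norm. -/
def EnergySpace : Type _ := T.VSpace × T.L2

namespace EnergySpace
variable {T}
instance : AddCommGroup T.EnergySpace := inferInstanceAs (AddCommGroup (T.VSpace × T.L2))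
instance : Module ℂ T.EnergySpace := inferInstanceAs (Module ℂ (T.VSpace × T.L2))

/-- The displacement component. -/
def disp (y : T.EnergySpace) : T.L2 := (Prod.fst y : T.VSpace)
/-- The velocity component. -/
def vel (y : T.EnergySpace) : T.L2 := Prod.snd y
lemma disp_mem (y : T.EnergySpace) : T.InV y.disp := (Prod.fst y : T.VSpace).2

/-- The state with displacement `u` and velocity `v`. -/
def mk (u v : T.L2) (hu : T.InV u) : T.EnergySpace := ((⟨u, hu⟩ : T.VSpace), v)

@[simp] lemma disp_mk (u v : T.L2) (hu : T.InV u) : (mk u v hu).disp = u := rfl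
@[simp] lemma vel_mk (u v : T.L2) (hu : T.InV u) : (mk u v hu).vel = v := rfl
@[simp] lemma disp_add (y z : T.EnergySpace) : (y + z).disp = y.disp + z.disp := rfl
@[simp] lemma vel_add (y z : T.EnergySpace) : (y + z).vel = y.vel + z.vel := rfl
@[simp] lemma disp_smul (c : ℂ) (y : T.EnergySpace) : (c • y).disp = c • y.disp := rfl
@[simp] lemma vel_smul (c : ℂ) (y : T.EnergySpace) : (c • y).vel = c • y.vel := rfl
@[simp] lemma disp_zero : (0 : T.EnergySpace).disp = 0 := rfl
@[simp] lemma vel_zero : (0 : T.EnergySpace).vel = 0 := rfl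
@[ext] lemma ext {y z : T.EnergySpace} (h : y.disp = z.disp) (h' : y.vel = z.vel) : y = z :=
  Prod.ext (Subtype.ext h) h'
end EnergySpace

/-- The energy inner product: `L²` products of first derivatives on strings, of second derivatives
on beams, and of velocities on all edges. -/
def energyInner (y z : T.EnergySpace) : ℂ :=
  (∑ e, inner ℂ (weakDeriv (T.kind e).order (y.disp e)) (weakDeriv (T.kind e).order (z.disp e)))
    + ∑ e, inner ℂ (y.vel e) (z.vel e)

variable {T}

lemma contRep_of_weakDeriv_zero {ℓ : ℝ} (hℓ : 0 < ℓ) {f : L2I ℓ} (h : IsWeakDeriv 1 f 0) :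
    ∃ c : ℂ, IsContRep f (fun _ => c) := by
  obtain ⟨c, h1, h2⟩ := h.exists_contRep hℓ
  refine ⟨c, continuousOn_const, h2.trans ?_⟩
  have hz := Lp.coeFn_zero ℂ 2 (volume.restrict (Ioo 0 ℓ))
  filter_upwards [ae_restrict_mem measurableSet_Ioo] with x hx
  rw [prim_eq hx, integral_eq_zero_of_ae, add_zero]
  filter_upwards [hz] with t ht
  rw [ht]; simp

/-- On each edge: zero energy gives an affine representative, of slope zero on strings. -/
lemma affine_of_zero {f : T.L2} (hf : T.InV f)
    (h0 : ∀ e, weakDeriv (T.kind e).order (f e) = 0) (e : E) :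
    ∃ c s : ℂ, IsContRep (f e) (fun x => c + x * s) ∧ (T.kind e = .string → s = 0) ∧
      (T.kind e = .beam → ∀ a, T.nodeVal 1 f e a = s) := by
  have hℓ := T.length_pos e
  have hr := hf.regular e
  have hsp := Sobolev.spec hr le_rfl
  rw [h0 e] at hsp
  cases hk : T.kind e with
  | string =>
    rw [hk] at hsp
    obtain ⟨c, hc⟩ := contRep_of_weakDeriv_zero hℓ hsp
    exact ⟨c, 0, by simpa using hc, fun _ => rfl, by simp⟩
  | beam =>
    rw [hk] at hsp hr
    have h1 := Sobolev.spec hr (by simp [Material.order] : 1 ≤ _)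
    obtain ⟨s, hs⟩ := contRep_of_weakDeriv_zero hℓ (h1.of_add (j := 1) hsp)
    obtain ⟨c, hc1, hc2⟩ := h1.exists_contRep hℓ
    refine ⟨c, s, ⟨by fun_prop, hc2.trans ?_⟩, by simp, ?_⟩
    · filter_upwards [ae_restrict_mem measurableSet_Ioo] with x hx
      rw [prim, intervalIntegral.integral_congr_ae (g := fun _ => s)]
      · simp
      · have := hs.2
        rw [Filter.EventuallyEq, ae_restrict_iff' measurableSet_Ioo] at this
        filter_upwards [this] with t ht htx
        rw [uIoc_of_le hx.1.le] at htx
        exact ht ⟨htx.1, htx.2.trans_lt hx.2⟩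
    · intro _ a
      exact hs.trace_eq hℓ (T.coord_mem a e)

lemma eq_zero_of_zero {f : T.L2} (hf : T.InV f)
    (h0 : ∀ e, weakDeriv (T.kind e).order (f e) = 0) : f = 0 := by
  classical
  choose c s hrep hstr hbeam using affine_of_zero hf h0
  have hval : ∀ e a, T.nodeVal 0 f e a = c e + T.coord a e * s e := by
    intro e a
    rw [nodeVal, weakDeriv_zero]
    exact (hrep e).trace_eq (T.length_pos e) (T.coord_mem a e)
  -- common vertex values
  have hsame : ∀ a, ∀ e ∈ T.incident a, ∀ e' ∈ T.incident a,
      T.nodeVal 0 f e a = T.nodeVal 0 f e' a := by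
    intro a e he e' he'
    by_cases h : e = e'
    · rw [h]
    · exact hf.continuous a ⟨e, he, e', he', h⟩ e he e' he'
  let p : V → ℂ := fun a => if h : ∃ e, e ∈ T.incident a then T.nodeVal 0 f h.choose a else 0
  have hp : ∀ a, ∀ e ∈ T.incident a, T.nodeVal 0 f e a = p a := by
    intro a e he
    have h : ∃ e, e ∈ T.incident a := ⟨e, he⟩
    simp only [p, dif_pos h]
    exact hsame a e he _ h.choose_spec
  have hti : ∀ e, p (T.term e) = c e + T.length e * s e := fun e => by
    rw [← hp _ e (Or.inr rfl), hval, coord_term]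
  have hin : ∀ e, p (T.init e) = c e := fun e => by
    rw [← hp _ e (Or.inl rfl), hval, coord_init]; simp
  have hroot : p T.root = 0 := by
    obtain ⟨e, he, _⟩ := T.root_exterior
    rw [← hp _ e he]; exact hf.root e he
  have hbal : ∀ a, a ≠ T.root → ∑ e, T.d a e * s e = 0 := by
    intro a ha
    have hred : ∑ e, T.d a e * s e = ∑ e ∈ T.edgesAt .beam a, T.d a e * T.nodeVal 1 f e a := by
      rw [← Finset.sum_subset (Finset.subset_univ (T.edgesAt .beam a))]
      · refine Finset.sum_congr rfl fun e he => ?_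
        rw [hbeam e (T.mem_edgesAt.1 he).2]
      · intro e _ he
        rw [mem_edgesAt, not_and_or] at he
        rcases he with he | he
        · simp only [incident, mem_ofPred_eq, not_or] at he
          simp [d, he.1, he.2]
        · have : T.kind e = .string := by
            cases h : T.kind e
            · rfl
            · exact absurd h he
          rw [hstr e this, mul_zero]
    rw [hred]
    by_cases hi : T.IsInterior a
    · exact hf.balance a hi
    · refine Finset.sum_eq_zero fun e he => ?_
      obtain ⟨he1, he2⟩ := T.mem_edgesAt.1 he
      rw [hf.clamped a ⟨e, he1, fun e' he' => ?_⟩ ha e he1 he2, mul_zero]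
      by_contra hne
      exact hi ⟨e', he', e, he1, hne⟩
  -- energy identity
  have hsum : ∑ e, (T.length e : ℂ) * (s e * conj (s e)) = 0 := by
    let S : Finset V := Finset.univ.image T.init ∪ Finset.univ.image T.term
    have h1 : ∀ e, (T.length e : ℂ) * (s e * conj (s e)) =
        ∑ a ∈ S, p a * conj (T.d a e * s e) := by
      intro e
      have hne := T.init_ne_term e
      rw [Finset.sum_eq_add (T.term e) (T.init e) hne.symm]
      · rw [hti, hin]
        simp [d, hne.symm]
        ring
      · intro a _ ha
        simp [d, ha.1.symm, ha.2.symm]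
      · intro h; exact absurd (by simp [S]) h
      · intro h; exact absurd (by simp [S]) h
    rw [Finset.sum_congr rfl fun e _ => h1 e, Finset.sum_comm]
    refine Finset.sum_eq_zero fun a _ => ?_
    rw [← Finset.mul_sum, ← map_sum]
    by_cases ha : a = T.root
    · rw [ha, hroot, zero_mul]
    · rw [hbal a ha]; simp
  have hs0 : ∀ e, s e = 0 := by
    have h2 : ∑ e, T.length e * Complex.normSq (s e) = 0 := by
      have : ((∑ e, T.length e * Complex.normSq (s e) : ℝ) : ℂ) = 0 := by
        rw [← hsum]; push_cast
        refine Finset.sum_congr rfl fun e _ => ?_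
        rw [Complex.mul_conj]
      exact_mod_cast this
    rw [Finset.sum_eq_zero_iff_of_nonneg
      (fun e _ => mul_nonneg (T.length_pos e).le (Complex.normSq_nonneg _))] at h2
    intro e
    have := h2 e (Finset.mem_univ e)
    rcases mul_eq_zero.1 this with h | h
    · exact absurd h (T.length_pos e).ne'
    · exact Complex.normSq_eq_zero.1 h
  have hpz : ∀ a, p a = 0 := by
    intro a
    suffices h : ∀ b, (SimpleGraph.fromEdgeSet (range fun e => s(T.init e, T.term e))).Walk a b →
        p b = 0 → p a = 0 by
      obtain ⟨w⟩ := T.isTree.connected.preconnected a T.root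
      exact h _ w hroot
    intro b w hb
    induction w with
    | nil => exact hb
    | cons hadj _ ih =>
      rw [SimpleGraph.fromEdgeSet_adj] at hadj
      obtain ⟨⟨e, he⟩, _⟩ := hadj
      have h3 : p (T.init e) = p (T.term e) := by rw [hti, hin, hs0]; simp
      rcases Sym2.eq_iff.1 he with ⟨h, h'⟩ | ⟨h, h'⟩
      · rw [← h, h3, h']; exact ih hb
      · rw [← h', ← h3, h]; exact ih hb
  funext e
  apply Lp.ext
  refine (hrep e).2.trans ?_
  have hz := Lp.coeFn_zero ℂ 2 (volume.restrict (Ioo 0 (T.length e)))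
  refine Filter.EventuallyEq.trans ?_ hz.symm
  filter_upwards with x
  rw [hs0, ← hin, hpz]; simp

variable (T)

/-- The energy inner product is a positive definite Hermitian form. -/
@[reducible] def energyCore : InnerProductSpace.Core ℂ T.EnergySpace where
  inner := T.energyInner
  conj_inner_symm y z := by
    simp [energyInner, map_add, map_sum, inner_conj_symm]
  re_inner_nonneg y := by
    simp only [energyInner, map_add, map_sum]
    exact add_nonneg (Finset.sum_nonneg fun e _ => inner_self_nonneg)
      (Finset.sum_nonneg fun e _ => inner_self_nonneg)
  add_left x y z := by
    have : ∀ e, weakDeriv (T.kind e).order ((x + y).disp e) =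
        weakDeriv (T.kind e).order (x.disp e) + weakDeriv (T.kind e).order (y.disp e) := fun e =>
      Sobolev.weakDeriv_add (x.disp_mem.regular e) (y.disp_mem.regular e) le_rfl
    simp only [energyInner, this, inner_add_left, Finset.sum_add_distrib, EnergySpace.vel_add,
      Pi.add_apply]
    ring
  smul_left x y r := by
    have : ∀ e, weakDeriv (T.kind e).order ((r • x).disp e) =
        r • weakDeriv (T.kind e).order (x.disp e) := fun e =>
      Sobolev.weakDeriv_smul (x.disp_mem.regular e) r le_rfl
    simp only [energyInner, this, inner_smul_left, EnergySpace.vel_smul,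
      Pi.smul_apply, mul_add, Finset.mul_sum]
  definite x hx := by
    have h1 : (∑ e, ‖weakDeriv (T.kind e).order (x.disp e)‖ ^ 2) + ∑ e, ‖x.vel e‖ ^ 2 = 0 := by
      have := congrArg Complex.re hx
      simpa [energyInner, inner_self_eq_norm_sq_to_K, ← Complex.ofReal_pow] using this
    have n1 : 0 ≤ ∑ e, ‖weakDeriv (T.kind e).order (x.disp e)‖ ^ 2 := by positivity
    have n2 : 0 ≤ ∑ e, ‖x.vel e‖ ^ 2 := by positivity
    have z1 : ∑ e, ‖weakDeriv (T.kind e).order (x.disp e)‖ ^ 2 = 0 := by linarith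
    have z2 : ∑ e, ‖x.vel e‖ ^ 2 = 0 := by linarith
    rw [Finset.sum_eq_zero_iff_of_nonneg (fun _ _ => by positivity)] at z1 z2
    ext1
    · exact eq_zero_of_zero x.disp_mem fun e => by simpa using z1 e (Finset.mem_univ e)
    · funext e
      simpa using z2 e (Finset.mem_univ e)

instance : NormedAddCommGroup T.EnergySpace := T.energyCore.toNormedAddCommGroup
instance : InnerProductSpace ℂ T.EnergySpace := InnerProductSpace.ofCore T.energyCore.toCore

lemma inner_eq (y z : T.EnergySpace) : inner ℂ y z = T.energyInner y z := rfl

/-- The domain of the operator: `u, v ∈ V` with `u` in `H²` on strings and in `H⁴` on beams, and the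
feedback, boundary and transmission conditions. -/
structure InDomain (u v : T.L2) : Prop where
  disp_mem : T.InV u
  vel_mem : T.InV v
  regular : ∀ e, u e ∈ Sobolev (T.length e) (2 * (T.kind e).order)
  string_feedback : ∀ a, T.IsExterior a → a ≠ T.root → ∀ e ∈ T.incident a,
    T.kind e = .string → T.nodeVal 1 u e a = -(T.d a e * T.nodeVal 0 v e a)
  root_moment : ∀ e ∈ T.incident T.root, T.kind e = .beam → T.nodeVal 2 u e T.root = 0
  moment_continuous : ∀ a, T.IsInterior a → ∀ e ∈ T.edgesAt .beam a, ∀ e' ∈ T.edgesAt .beam a,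
    T.nodeVal 2 u e a = T.nodeVal 2 u e' a
  beam_feedback : ∀ a, T.IsExterior a → a ≠ T.root → ∀ e ∈ T.incident a,
    T.kind e = .beam → T.nodeVal 3 u e a = T.d a e * T.nodeVal 0 v e a
  force_balance : ∀ a, T.IsInterior a →
    ∑ e ∈ T.edgesAt .string a, T.d a e * T.nodeVal 1 u e a
      - ∑ e ∈ T.edgesAt .beam a, T.d a e * T.nodeVal 3 u e a = 0

variable {T} in
lemma InDomain.regular_kind {u v : T.L2} (h : T.InDomain u v) {e : E} {m : Material}
    (he : T.kind e = m) : u e ∈ Sobolev (T.length e) (2 * m.order) := he ▸ h.regular e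

lemma inDomain_zero : T.InDomain 0 0 := by
  refine ⟨T.VSpace.zero_mem, T.VSpace.zero_mem, fun e => zero_mem _, ?_, ?_, ?_, ?_, ?_⟩ <;>
    simp [nodeVal_zero]

variable {T} in
lemma InDomain.add {u v u' v' : T.L2} (h : T.InDomain u v) (h' : T.InDomain u' v') :
    T.InDomain (u + u') (v + v') := by
  have hS : ∀ {e k}, T.kind e = .string → k + 1 ≤ 2 → ∀ a, T.nodeVal k (u + u') e a =
      T.nodeVal k u e a + T.nodeVal k u' e a := fun he hk a =>
    nodeVal_add (h.regular_kind he) (h'.regular_kind he) hk a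
  have hB : ∀ {e k}, T.kind e = .beam → k + 1 ≤ 4 → ∀ a, T.nodeVal k (u + u') e a =
      T.nodeVal k u e a + T.nodeVal k u' e a := fun he hk a =>
    nodeVal_add (h.regular_kind he) (h'.regular_kind he) hk a
  have hv : ∀ e a, T.nodeVal 0 (v + v') e a = T.nodeVal 0 v e a + T.nodeVal 0 v' e a :=
    fun e a => nodeVal_add (h.vel_mem.regular e) (h'.vel_mem.regular e) (T.kind e).order_pos a
  refine ⟨T.VSpace.add_mem h.disp_mem h'.disp_mem, T.VSpace.add_mem h.vel_mem h'.vel_mem,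
    fun e => add_mem (h.regular e) (h'.regular e), ?_, ?_, ?_, ?_, ?_⟩
  · intro a ha har e he hk
    rw [hS hk (by norm_num), hv, h.string_feedback a ha har e he hk,
      h'.string_feedback a ha har e he hk]
    ring
  · intro e he hk
    rw [hB hk (by norm_num), h.root_moment e he hk, h'.root_moment e he hk, add_zero]
  · intro a ha e he e' he'
    rw [hB (T.mem_edgesAt.1 he).2 (by norm_num), hB (T.mem_edgesAt.1 he').2 (by norm_num),
      h.moment_continuous a ha e he e' he', h'.moment_continuous a ha e he e' he']
  · intro a ha har e he hk
    rw [hB hk (by norm_num), hv, h.beam_feedback a ha har e he hk,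
      h'.beam_feedback a ha har e he hk]
    ring
  · intro a ha
    have e1 : ∑ e ∈ T.edgesAt .string a, T.d a e * T.nodeVal 1 (u + u') e a =
        ∑ e ∈ T.edgesAt .string a, T.d a e * T.nodeVal 1 u e a +
        ∑ e ∈ T.edgesAt .string a, T.d a e * T.nodeVal 1 u' e a := by
      rw [← Finset.sum_add_distrib]
      refine Finset.sum_congr rfl fun e he => ?_
      rw [hS (T.mem_edgesAt.1 he).2 (by norm_num), mul_add]
    have e2 : ∑ e ∈ T.edgesAt .beam a, T.d a e * T.nodeVal 3 (u + u') e a =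
        ∑ e ∈ T.edgesAt .beam a, T.d a e * T.nodeVal 3 u e a +
        ∑ e ∈ T.edgesAt .beam a, T.d a e * T.nodeVal 3 u' e a := by
      rw [← Finset.sum_add_distrib]
      refine Finset.sum_congr rfl fun e he => ?_
      rw [hB (T.mem_edgesAt.1 he).2 (by norm_num), mul_add]
    rw [e1, e2]
    linear_combination h.force_balance a ha + h'.force_balance a ha

variable {T} in
lemma InDomain.smul {u v : T.L2} (c : ℂ) (h : T.InDomain u v) :
    T.InDomain (c • u) (c • v) := by
  have hS : ∀ {e k}, T.kind e = .string → k + 1 ≤ 2 → ∀ a, T.nodeVal k (c • u) e a =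
      c * T.nodeVal k u e a := fun he hk a => nodeVal_smul (h.regular_kind he) c hk a
  have hB : ∀ {e k}, T.kind e = .beam → k + 1 ≤ 4 → ∀ a, T.nodeVal k (c • u) e a =
      c * T.nodeVal k u e a := fun he hk a => nodeVal_smul (h.regular_kind he) c hk a
  have hv : ∀ e a, T.nodeVal 0 (c • v) e a = c * T.nodeVal 0 v e a :=
    fun e a => nodeVal_smul (h.vel_mem.regular e) c (T.kind e).order_pos a
  refine ⟨T.VSpace.smul_mem c h.disp_mem, T.VSpace.smul_mem c h.vel_mem,
    fun e => Submodule.smul_mem _ c (h.regular e), ?_, ?_, ?_, ?_, ?_⟩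
  · intro a ha har e he hk
    rw [hS hk (by norm_num), hv, h.string_feedback a ha har e he hk]
    ring
  · intro e he hk
    rw [hB hk (by norm_num), h.root_moment e he hk, mul_zero]
  · intro a ha e he e' he'
    rw [hB (T.mem_edgesAt.1 he).2 (by norm_num), hB (T.mem_edgesAt.1 he').2 (by norm_num),
      h.moment_continuous a ha e he e' he']
  · intro a ha har e he hk
    rw [hB hk (by norm_num), hv, h.beam_feedback a ha har e he hk]
    ring
  · intro a ha
    have e1 : ∑ e ∈ T.edgesAt .string a, T.d a e * T.nodeVal 1 (c • u) e a =
        c * ∑ e ∈ T.edgesAt .string a, T.d a e * T.nodeVal 1 u e a := by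
      rw [Finset.mul_sum]
      refine Finset.sum_congr rfl fun e he => ?_
      rw [hS (T.mem_edgesAt.1 he).2 (by norm_num)]; ring
    have e2 : ∑ e ∈ T.edgesAt .beam a, T.d a e * T.nodeVal 3 (c • u) e a =
        c * ∑ e ∈ T.edgesAt .beam a, T.d a e * T.nodeVal 3 u e a := by
      rw [Finset.mul_sum]
      refine Finset.sum_congr rfl fun e he => ?_
      rw [hB (T.mem_edgesAt.1 he).2 (by norm_num)]; ring
    rw [e1, e2]
    linear_combination c * h.force_balance a ha

/-- `∂²u` on strings and `-∂⁴u` on beams. -/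
def elastic (u : T.L2) (e : E) : L2I (T.length e) :=
  match T.kind e with
  | .string => weakDeriv 2 (u e)
  | .beam => -weakDeriv 4 (u e)

/-- The operator `A (u, v) = (v, ∂²u)` on strings and `A (u, v) = (v, -∂⁴u)` on beams. -/
def operator : T.EnergySpace →ₗ.[ℂ] T.EnergySpace where
  domain :=
    { carrier := {y | T.InDomain y.disp y.vel}
      zero_mem' := T.inDomain_zero
      add_mem' := fun h h' => h.add h'
      smul_mem' := fun c _ h => h.smul c }
  toFun :=
    { toFun := fun y => EnergySpace.mk y.1.vel (T.elastic y.1.disp) y.2.vel_mem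
      map_add' := by
        intro y z
        ext1
        · rfl
        · funext e
          have hy := y.2.regular e
          have hz := z.2.regular e
          simp only [EnergySpace.vel_mk, EnergySpace.vel_add, Pi.add_apply, elastic]
          cases hk : T.kind e
          · rw [hk] at hy hz
            exact Sobolev.weakDeriv_add hy hz (by simp [Material.order])
          · rw [hk] at hy hz
            have := Sobolev.weakDeriv_add hy hz (k := 4) (by simp [Material.order])
            simp only [← neg_add]
            exact congrArg _ this
      map_smul' := by
        intro c y
        ext1
        · rfl
        · funext e
          have hy := y.2.regular e
          simp only [EnergySpace.vel_mk, EnergySpace.vel_smul, Pi.smul_apply, elastic,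
            RingHom.id_apply]
          cases hk : T.kind e
          · rw [hk] at hy
            exact Sobolev.weakDeriv_smul hy c (by simp [Material.order])
          · rw [hk] at hy
            have := Sobolev.weakDeriv_smul hy c (k := 4) (by simp [Material.order])
            simp only [smul_neg]
            exact congrArg _ this }

end Network

section Semigroup

variable {X : Type*} [NormedAddCommGroup X] [NormedSpace ℂ X]

/-- `S` is a `C₀`-semigroup of contractions. -/
structure IsContractionSemigroup (S : ℝ≥0 → X →L[ℂ] X) : Prop where
  map_zero : S 0 = ContinuousLinearMap.id ℂ X
  map_add : ∀ s t, S (s + t) = (S s).comp (S t)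
  strongly_continuous : ∀ x, Tendsto (fun t => S t x) (𝓝 0) (𝓝 x)
  contraction : ∀ t x, ‖S t x‖ ≤ ‖x‖

/-- `A` is the infinitesimal generator of `S`: `x` lies in the domain of `A` and `A x = z` exactly
when `(S t x - x) / t` tends to `z` as `t` decreases to `0`. -/
def IsGenerator (A : X →ₗ.[ℂ] X) (S : ℝ≥0 → X →L[ℂ] X) : Prop :=
  ∀ x z, (x, z) ∈ A.graph ↔
    Tendsto (fun t : ℝ≥0 => (t : ℝ)⁻¹ • (S t x - x)) (𝓝[>] 0) (𝓝 z)

/-- `y`, restricted to `[0,∞)`, is a mild solution of `dy/dt = A y`, `y(0) = y₀`: it is continuous and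
for all `t ≥ 0` the integral of `y` over `[0,t]` lies in the domain of `A` and is mapped by `A` to
`y(t) - y₀`. -/
structure IsMildSolution (A : X →ₗ.[ℂ] X) (y₀ : X) (y : ℝ → X) : Prop where
  continuousOn : ContinuousOn y (Ici 0)
  integral_eq : ∀ t, 0 ≤ t → (∫ s in 0..t, y s, y t - y₀) ∈ A.graph

/-- `y`, restricted to `[0,∞)`, is a solution of `dy/dt = A y`, `y(0) = y₀` in the class
`C([0,∞), D(A)) ∩ C¹([0,∞), X)`, where `D(A)` has the graph norm. -/
structure IsClassicalSolution (A : X →ₗ.[ℂ] X) (y₀ : X) (y : ℝ → X) : Prop where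
  initial : y 0 = y₀
  mem_domain : ∀ t, 0 ≤ t → y t ∈ A.domain
  continuous_graph : Continuous fun t : Ici (0 : ℝ) => (y t, A ⟨y t, mem_domain t t.2⟩)
  contDiffOn : ContDiffOn ℝ 1 y (Ici 0)
  equation : ∀ t (ht : 0 ≤ t), HasDerivWithinAt y (A ⟨y t, mem_domain t ht⟩) (Ici 0) t

end Semigroup

end StringBeam
end

/-!
The operator `A` is shown to be maximal dissipative on the energy space, and the Lumer–Phillips
theorem then gives the semigroup and the solutions of the evolution equation.

*Generation.* Let `A` be dissipative on a Hilbert space with `c - A` onto for every `c > 0`. Then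
the domain of `A` is dense, and the exponentials of the Yosida approximations `n A (n - A)⁻¹` are
contractions that converge strongly to a contraction semigroup with generator `A`
(`IsMaximalDissipative.isGenerator`). The orbit of `x` is a mild solution, since `w = ∫₀ᵗ S(s) x ds`
satisfies `w = (1 - A)⁻¹ (w - (S(t) x - x))`. It is the only one, since the integral `w` of the
difference of two mild solutions has `w' = A w` and `w(0) = 0`, so that its norm does not increase.

*Completeness.* On each edge a function is determined by its derivative of order `1` (string) or `2`
(beam) together with its value and slope at one end. Thus the admissible displacements form a closed
subspace of `∏ L²` plus a finite dimensional space. A function of zero energy vanishes, so the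
projection of this subspace to `∏ L²` is injective; its range is closed, because the kernel of the
projection on the whole space is finite dimensional. The open mapping theorem yields the Poincaré
inequality `exists_norm_le`, hence the completeness of the energy space and the continuity of the
displacements and of their vertex values in the energy norm.

*Dissipativity.* By Green's formula on each edge, rearranged as a sum over the vertices, the real
part of `⟨A y, y⟩` equals minus the sum of `|v(a)|²` over the exterior vertices `a` other than the
root (`re_inner_operator_nonpos`).

*Range.* Eliminating the velocity from `c y - A y = z` leaves a variational problem whose form is
the energy product plus a bounded positive form, so that it has a solution
(`exists_resolvent_operator`). Test functions supported on a single edge and vanishing at its ends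
(to second order on beams) show that the highest derivative of the solution is orthogonal, up to an
explicit primitive of the data, to the orthogonal complement of the constant or affine functions;
this gives regularity (`IsWeakSolution.regular`). Test functions with prescribed vertex values and
slopes, affine on strings and cubic on beams, then yield the remaining conditions of the domain
(`IsWeakSolution.inDomain`).
-/

noncomputable section
namespace StringBeam

/-! ### The Lumer–Phillips theorem on a Hilbert space -/

section LumerPhillips

variable {X : Type*} [NormedAddCommGroup X] [InnerProductSpace ℂ X]

/-- The operator `A` is dissipative and `c - A` is onto for every `c > 0`. Both conditions are stated
on the graph: `(x, c x - z)` lies in it exactly when `x` is in the domain and `c x - A x = z`. -/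
structure IsMaximalDissipative (A : X →ₗ.[ℂ] X) : Prop where
  re_inner_nonpos : ∀ {x w : X}, (x, w) ∈ A.graph → (inner ℂ w x).re ≤ 0
  exists_resolvent : ∀ c : ℝ, 0 < c → ∀ z : X, ∃ x, (x, (c : ℂ) • x - z) ∈ A.graph

/-- A curve whose velocity has nowhere positive inner product with its position does not move away
from the origin. -/
lemma norm_le_of_re_inner_nonpos {f f' : ℝ → X} (hc : ContinuousOn f (Ici 0))
    (hd : ∀ t, 0 < t → HasDerivAt f (f' t) t) (hre : ∀ t, 0 < t → (inner ℂ (f' t) (f t)).re ≤ 0)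
    {t : ℝ} (ht : 0 ≤ t) : ‖f t‖ ≤ ‖f 0‖ := by
  have hder : ∀ t, 0 < t → HasDerivAt (fun t => ‖f t‖ ^ 2) (2 * (inner ℂ (f' t) (f t)).re) t := by
    intro t ht
    have h1 : HasDerivAt (fun t => (inner ℂ (f t) (f t)).re)
        (inner ℂ (f t) (f' t) + inner ℂ (f' t) (f t)).re t :=
      Complex.reCLM.hasFDerivAt.comp_hasDerivAt t ((hd t ht).inner ℂ (hd t ht))
    have h2 : (fun t => ‖f t‖ ^ 2) = fun t => (inner ℂ (f t) (f t)).re := by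
      funext s
      exact (inner_self_eq_norm_sq (𝕜 := ℂ) (f s)).symm
    have h3 : (inner ℂ (f t) (f' t)).re = (inner ℂ (f' t) (f t)).re :=
      inner_re_symm (𝕜 := ℂ) (f t) (f' t)
    rwa [Complex.add_re, h3, ← two_mul, ← h2] at h1
  have hanti : AntitoneOn (fun t => ‖f t‖ ^ 2) (Ici 0) := by
    refine antitoneOn_of_deriv_nonpos (convex_Ici 0) (hc.norm.pow 2) ?_ ?_
    · rw [interior_Ici]
      exact fun t ht => (hder t ht).differentiableAt.differentiableWithinAt
    · rw [interior_Ici]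
      intro t ht
      rw [(hder t ht).deriv]
      have := hre t ht
      linarith
  exact (pow_le_pow_iff_left₀ (norm_nonneg _) (norm_nonneg _) two_ne_zero).1
    (hanti self_mem_Ici ht ht)

/-- Convergence to zero of a bounded family of operators has to be checked on a dense set only. -/
lemma tendsto_zero_of_dense {ι : Type*} {l : Filter ι} {L : ι → X →L[ℂ] X} {C : ℝ}
    (hC : ∀ i, ‖L i‖ ≤ C) {D : Set X} (hD : Dense D)
    (h : ∀ x ∈ D, Tendsto (fun i => L i x) l (𝓝 0)) (x : X) :
    Tendsto (fun i => L i x) l (𝓝 0) := by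
  have hC' : ∀ i, ‖L i‖ ≤ |C| + 1 := fun i => (hC i).trans (by linarith [le_abs_self C])
  have hpos : 0 < |C| + 1 := by positivity
  rw [Metric.tendsto_nhds]
  intro ε hε
  obtain ⟨d, hxd, hd⟩ := Metric.dense_iff.1 hD x (ε / 2 / (|C| + 1)) (by positivity)
  filter_upwards [Metric.tendsto_nhds.1 (h d hd) (ε / 2) (by positivity)] with i hi
  rw [dist_zero_right] at hi ⊢
  rw [Metric.mem_ball, dist_eq_norm, lt_div_iff₀ hpos, norm_sub_rev] at hxd
  have h1 : ‖L i (x - d)‖ ≤ (|C| + 1) * ‖x - d‖ := (L i).le_of_opNorm_le (hC' i) _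
  have h2 : ‖L i x‖ ≤ ‖L i (x - d)‖ + ‖L i d‖ := by
    refine le_trans (le_of_eq ?_) (norm_add_le _ _)
    rw [map_sub, sub_add_cancel]
  linarith

lemma hasDerivAt_operator_apply {F : ℝ → X →L[ℂ] X} {F' : X →L[ℂ] X} {t : ℝ}
    (h : HasDerivAt F F' t) (x : X) : HasDerivAt (fun t => F t x) (F' x) t :=
  ((ContinuousLinearMap.apply ℂ X x).restrictScalars ℝ).hasFDerivAt.comp_hasDerivAt t h

namespace IsMaximalDissipative

variable {A : X →ₗ.[ℂ] X} (hA : IsMaximalDissipative A)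
include hA

/-- Dissipativity bounds the resolvent: `c ‖x‖ ≤ ‖c x - A x‖`. -/
lemma mul_norm_le {c : ℝ} {x w : X} (hx : (x, w) ∈ A.graph) : c * ‖x‖ ≤ ‖(c : ℂ) • x - w‖ := by
  have h1 : (inner ℂ ((c : ℂ) • x - w) x).re ≤ ‖(c : ℂ) • x - w‖ * ‖x‖ :=
    re_inner_le_norm (𝕜 := ℂ) _ _
  have h2 := hA.re_inner_nonpos hx
  have h3 : (inner ℂ ((c : ℂ) • x - w) x).re = c * ‖x‖ ^ 2 - (inner ℂ w x).re := by
    rw [inner_sub_left, inner_smul_left, inner_self_eq_norm_sq_to_K, Complex.conj_ofReal]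
    simp [← Complex.ofReal_pow]
  rcases (norm_nonneg x).eq_or_lt with h0 | h0
  · rw [← h0, mul_zero]; exact norm_nonneg _
  · rw [h3] at h1
    by_contra hcon
    nlinarith

lemma eq_of_mem_graph {c : ℝ} (hc : 0 < c) {x x' z : X} (hx : (x, (c : ℂ) • x - z) ∈ A.graph)
    (hx' : (x', (c : ℂ) • x' - z) ∈ A.graph) : x = x' := by
  have h := hA.mul_norm_le (c := c) (A.graph.sub_mem hx hx')
  have h2 : (c : ℂ) • (x - x') - ((c : ℂ) • x - z - ((c : ℂ) • x' - z)) = 0 := by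
    rw [smul_sub]; abel
  rw [h2, norm_zero] at h
  have : ‖x - x'‖ ≤ 0 := by
    by_contra hcon
    nlinarith
  exact sub_eq_zero.1 (norm_le_zero_iff.1 this)

omit hA in
/-- The resolvent `(n + 1 - A)⁻¹`. -/
def resolvent (hA : IsMaximalDissipative A) (n : ℕ) : X →L[ℂ] X :=
  LinearMap.mkContinuous
    { toFun := fun z => (hA.exists_resolvent (n + 1) (by positivity) z).choose
      map_add' := fun z z' => by
        refine hA.eq_of_mem_graph (c := n + 1) (by positivity)
          (hA.exists_resolvent (n + 1) (by positivity) (z + z')).choose_spec ?_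
        have h := A.graph.add_mem (hA.exists_resolvent (n + 1) (by positivity) z).choose_spec
          (hA.exists_resolvent (n + 1) (by positivity) z').choose_spec
        convert h using 1
        rw [Prod.mk_add_mk, smul_add]
        congr 1
        abel
      map_smul' := fun a z => by
        refine hA.eq_of_mem_graph (c := n + 1) (by positivity)
          (hA.exists_resolvent (n + 1) (by positivity) (a • z)).choose_spec ?_
        have h := A.graph.smul_mem a (hA.exists_resolvent (n + 1) (by positivity) z).choose_spec
        convert h using 1
        rw [RingHom.id_apply, Prod.smul_mk, smul_sub, smul_comm] }
    ((n : ℝ) + 1)⁻¹ fun z => by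
      have hspec := (hA.exists_resolvent (n + 1) (by positivity) z).choose_spec
      have h := hA.mul_norm_le (c := n + 1) hspec
      rw [sub_sub_cancel] at h
      rw [inv_mul_eq_div, le_div_iff₀' (by positivity)]
      exact h

lemma resolvent_mem (n : ℕ) (z : X) :
    (hA.resolvent n z, ((n : ℂ) + 1) • hA.resolvent n z - z) ∈ A.graph := by
  have h : (hA.resolvent n z, (((n : ℝ) + 1 : ℝ) : ℂ) • hA.resolvent n z - z) ∈ A.graph :=
    (hA.exists_resolvent (n + 1) (by positivity) z).choose_spec
  push_cast at h
  exact h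

lemma resolvent_eq {n : ℕ} {x z : X} (h : (x, ((n : ℂ) + 1) • x - z) ∈ A.graph) :
    hA.resolvent n z = x :=
  hA.eq_of_mem_graph (c := n + 1) (by positivity)
    (hA.exists_resolvent (n + 1) (by positivity) z).choose_spec (by push_cast; exact h)

lemma norm_resolvent_le (n : ℕ) (z : X) : ‖hA.resolvent n z‖ ≤ ((n : ℝ) + 1)⁻¹ * ‖z‖ :=
  (hA.resolvent n).le_of_opNorm_le (LinearMap.mkContinuous_norm_le _ (by positivity) _) z

lemma resolvent_of_mem_graph (n : ℕ) {x w : X} (h : (x, w) ∈ A.graph) :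
    hA.resolvent n (((n : ℂ) + 1) • x - w) = x :=
  hA.resolvent_eq (by rwa [sub_sub_cancel])

lemma resolvent_comm (m n : ℕ) : Commute (hA.resolvent m) (hA.resolvent n) := by
  ext z
  change hA.resolvent m (hA.resolvent n z) = hA.resolvent n (hA.resolvent m z)
  set q := hA.resolvent m z with hq
  set p := hA.resolvent n q with hp
  have hqm := hA.resolvent_mem m z
  have hpm := hA.resolvent_mem n q
  rw [← hq] at hqm
  rw [← hp] at hpm
  -- the resolvent identity
  have h1 : hA.resolvent n z = q + ((m : ℂ) - n) • p := by
    apply hA.resolvent_eq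
    convert A.graph.add_mem hqm (A.graph.smul_mem ((m : ℂ) - n) hpm) using 1
    ext1
    · rfl
    · simp only [Prod.snd_add, Prod.smul_snd]
      module
  rw [h1]
  apply hA.resolvent_eq
  convert hpm using 2
  module

/-- The domain of a maximal dissipative operator on a Hilbert space is dense: if `z = x - A x` is
orthogonal to the domain, then `‖x‖² ≤ 0`. -/
lemma dense_domain [CompleteSpace X] : Dense (A.domain : Set X) := by
  rw [Submodule.dense_iff_topologicalClosure_eq_top, Submodule.topologicalClosure_eq_top_iff,
    Submodule.eq_bot_iff]
  intro z hz
  have hm := hA.resolvent_mem 0 z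
  set x := hA.resolvent 0 z with hx
  have hxd : x ∈ A.domain := LinearPMap.mem_domain_of_mem_graph hm
  have h0 : inner ℂ z x = 0 := (Submodule.mem_orthogonal' _ _).1 hz x hxd
  have h1 := hA.re_inner_nonpos hm
  have h2 : (inner ℂ ((((0 : ℕ) : ℂ) + 1) • x - z) x).re = ‖x‖ ^ 2 := by
    rw [inner_sub_left, h0]
    simpa using inner_self_eq_norm_sq (𝕜 := ℂ) x
  rw [h2] at h1
  have hx0 : x = 0 := by
    rw [← norm_eq_zero]; nlinarith [norm_nonneg x]
  rw [hx0] at hm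
  have := A.graph_fst_eq_zero_snd hm rfl
  simpa using this

/-- The Yosida approximation `(n + 1) A (n + 1 - A)⁻¹`. -/
def yosida (n : ℕ) : X →L[ℂ] X :=
  ((n : ℂ) + 1) • (((n : ℂ) + 1) • hA.resolvent n - 1)

lemma yosida_apply (n : ℕ) {x w : X} (h : (x, w) ∈ A.graph) :
    hA.yosida n x = ((n : ℂ) + 1) • hA.resolvent n w := by
  have h1 := hA.resolvent_of_mem_graph n h
  rw [map_sub, map_smul, sub_eq_iff_eq_add] at h1
  simp only [yosida, FunLike.coe_smul, FunLike.coe_sub, Pi.smul_apply, Pi.sub_apply, h1,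
    one_apply_eq_self, add_sub_cancel_left]

lemma norm_smul_resolvent_le (n : ℕ) (z : X) :
    ‖((n : ℂ) + 1) • hA.resolvent n z‖ ≤ ‖z‖ := by
  have h1 : ‖((n : ℂ) + 1)‖ = (n : ℝ) + 1 := by
    rw [← Nat.cast_add_one, Complex.norm_natCast]; push_cast; rfl
  rw [norm_smul, h1, ← le_div_iff₀' (by positivity), div_eq_inv_mul]
  exact hA.norm_resolvent_le n z

lemma yosida_dissipative (n : ℕ) (x : X) : (inner ℂ (hA.yosida n x) x).re ≤ 0 := by
  have h1 : (inner ℂ (((n : ℂ) + 1) • hA.resolvent n x) x).re ≤ ‖x‖ * ‖x‖ :=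
    (re_inner_le_norm (𝕜 := ℂ) _ _).trans
      (mul_le_mul_of_nonneg_right (hA.norm_smul_resolvent_le n x) (norm_nonneg x))
  have h2 : (inner ℂ x x).re = ‖x‖ ^ 2 := inner_self_eq_norm_sq (𝕜 := ℂ) x
  have h3 : (inner ℂ (hA.yosida n x) x).re =
      ((n : ℝ) + 1) * ((inner ℂ (((n : ℂ) + 1) • hA.resolvent n x) x).re - ‖x‖ ^ 2) := by
    have h4 : hA.yosida n x =
        (((n : ℝ) + 1 : ℝ) : ℂ) • (((n : ℂ) + 1) • hA.resolvent n x - x) := by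
      push_cast; rfl
    rw [h4, inner_smul_left, Complex.conj_ofReal, Complex.re_ofReal_mul, inner_sub_left,
      Complex.sub_re, h2]
  rw [h3]
  refine mul_nonpos_of_nonneg_of_nonpos (by positivity) ?_
  nlinarith

variable [CompleteSpace X]

/-- On the whole space, `(n + 1) (n + 1 - A)⁻¹` converges strongly to the identity. -/
lemma tendsto_smul_resolvent (x : X) :
    Tendsto (fun n : ℕ => ((n : ℂ) + 1) • hA.resolvent n x) atTop (𝓝 x) := by
  have key := tendsto_zero_of_dense (l := atTop)
    (L := fun n : ℕ => ((n : ℂ) + 1) • hA.resolvent n - 1) (C := 2) ?_ hA.dense_domain ?_ x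
  · rw [← tendsto_sub_nhds_zero_iff]
    exact key
  · intro n
    refine ContinuousLinearMap.opNorm_le_bound _ zero_le_two fun z => ?_
    have h1 := norm_sub_le (((n : ℂ) + 1) • hA.resolvent n z) z
    have h2 := hA.norm_smul_resolvent_le n z
    calc _ ≤ _ := h1
      _ ≤ 2 * ‖z‖ := by linarith
  · intro z hz
    obtain ⟨w, hw⟩ := LinearPMap.mem_domain_iff.1 hz
    have h1 : ∀ n : ℕ, (((n : ℂ) + 1) • hA.resolvent n - 1) z = hA.resolvent n w := by
      intro n
      have h := hA.resolvent_of_mem_graph n hw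
      rw [map_sub, map_smul, sub_eq_iff_eq_add] at h
      change ((n : ℂ) + 1) • hA.resolvent n z - z = _
      rw [h, add_sub_cancel_left]
    simp only [h1]
    refine squeeze_zero_norm (fun n => hA.norm_resolvent_le n w) ?_
    have h2 := (tendsto_one_div_add_atTop_nhds_zero_nat (𝕜 := ℝ)).mul_const ‖w‖
    simpa using h2

lemma tendsto_yosida {x w : X} (h : (x, w) ∈ A.graph) :
    Tendsto (fun n => hA.yosida n x) atTop (𝓝 w) := by
  simp only [hA.yosida_apply _ h]
  exact hA.tendsto_smul_resolvent w

/-- The semigroup generated by the Yosida approximation. -/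
def yosidaExp (n : ℕ) (t : ℝ) : X →L[ℂ] X := NormedSpace.exp (t • hA.yosida n)

lemma yosidaExp_zero (n : ℕ) : hA.yosidaExp n 0 = 1 := by
  rw [yosidaExp, zero_smul, NormedSpace.exp_zero]

omit [CompleteSpace X] in
lemma yosida_comm (m n : ℕ) : Commute (hA.yosida m) (hA.yosida n) :=
  .smul_left (.smul_right (.sub_left (.sub_right (.smul_left (.smul_right (hA.resolvent_comm m n) _) _)
    (.one_right _)) (.one_left _)) _) _

lemma yosidaExp_add (n : ℕ) (s t : ℝ) :
    hA.yosidaExp n (s + t) = hA.yosidaExp n s * hA.yosidaExp n t := by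
  let _ : NormedAlgebra ℚ (X →L[ℂ] X) := .restrictScalars ℚ ℝ _
  rw [yosidaExp, add_smul, NormedSpace.exp_add_of_commute]
  · rfl
  · exact ((Commute.refl _).smul_left _).smul_right _

lemma hasDerivAt_yosidaExp (n : ℕ) (t : ℝ) :
    HasDerivAt (hA.yosidaExp n) (hA.yosidaExp n t * hA.yosida n) t :=
  hasDerivAt_exp_smul_const (hA.yosida n) t

lemma resolvent_comm_yosidaExp (m n : ℕ) (t : ℝ) :
    Commute (hA.resolvent m) (hA.yosidaExp n t) := by
  refine Commute.exp_right (Commute.smul_right ?_ t)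
  exact .smul_right (.sub_right (.smul_right (hA.resolvent_comm m n) _) (.one_right _)) _

lemma yosida_comm_yosidaExp (m n : ℕ) (t : ℝ) :
    Commute (hA.yosida m) (hA.yosidaExp n t) :=
  Commute.exp_right ((hA.yosida_comm m n).smul_right t)

lemma hasDerivAt_yosidaExp_apply (n : ℕ) (x : X) (t : ℝ) :
    HasDerivAt (fun t => hA.yosidaExp n t x) (hA.yosidaExp n t (hA.yosida n x)) t :=
  hasDerivAt_operator_apply (hA.hasDerivAt_yosidaExp n t) x

lemma norm_yosidaExp_apply_le (n : ℕ) (x : X) {t : ℝ} (ht : 0 ≤ t) :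
    ‖hA.yosidaExp n t x‖ ≤ ‖x‖ := by
  have h := norm_le_of_re_inner_nonpos (f := fun t => hA.yosidaExp n t x)
    (fun s _ => (hA.hasDerivAt_yosidaExp_apply n x s).continuousAt.continuousWithinAt)
    (fun s _ => hA.hasDerivAt_yosidaExp_apply n x s) (fun s _ => ?_) ht
  · simpa [hA.yosidaExp_zero] using h
  · have h1 : hA.yosidaExp n s (hA.yosida n x) = hA.yosida n (hA.yosidaExp n s x) :=
      (congrArg (fun L : X →L[ℂ] X => L x) (hA.yosida_comm_yosidaExp n n s).eq).symm
    rw [h1]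
    exact hA.yosida_dissipative n _

/-- The two approximating semigroups are compared along the path
`s ↦ exp (s Aₘ) exp ((t - s) Aₙ) x`. -/
lemma norm_yosidaExp_sub_le (m n : ℕ) (x : X) {t : ℝ} (ht : 0 ≤ t) :
    ‖hA.yosidaExp m t x - hA.yosidaExp n t x‖ ≤ ‖hA.yosida m x - hA.yosida n x‖ * t := by
  have hd : ∀ s, HasDerivAt (fun s => hA.yosidaExp m s (hA.yosidaExp n (t - s) x))
      (hA.yosidaExp m s (hA.yosidaExp n (t - s) (hA.yosida m x - hA.yosida n x))) s := by
    intro s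
    have h1 := (hA.hasDerivAt_yosidaExp n (t - s)).comp_const_sub t s
    have h2 : HasDerivAt (fun s => hA.yosidaExp m s (hA.yosidaExp n (t - s) x))
        (hA.yosidaExp m s (hA.yosida m (hA.yosidaExp n (t - s) x)) +
          hA.yosidaExp m s (-hA.yosidaExp n (t - s) (hA.yosida n x))) s :=
      hasDerivAt_operator_apply ((hA.hasDerivAt_yosidaExp m s).mul h1) x
    have h3 : hA.yosida m (hA.yosidaExp n (t - s) x) = hA.yosidaExp n (t - s) (hA.yosida m x) :=
      congrArg (fun L : X →L[ℂ] X => L x) (hA.yosida_comm_yosidaExp m n (t - s)).eq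
    rwa [h3, ← map_add, ← sub_eq_add_neg, ← map_sub] at h2
  have h := norm_image_sub_le_of_norm_deriv_le_segment' (a := 0) (b := t)
    (C := ‖hA.yosida m x - hA.yosida n x‖) (fun s _ => (hd s).hasDerivWithinAt)
    (fun s hs => (hA.norm_yosidaExp_apply_le m _ hs.1).trans
      (hA.norm_yosidaExp_apply_le n _ (sub_nonneg.2 hs.2.le))) t ⟨ht, le_rfl⟩
  simpa [hA.yosidaExp_zero] using h

lemma exists_tendsto_yosidaExp (t : ℝ≥0) (x : X) :
    ∃ y, Tendsto (fun n => hA.yosidaExp n t x) atTop (𝓝 y) := by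
  apply cauchySeq_tendsto_of_complete
  rw [cauchySeq_iff_tendsto_dist_atTop_0]
  simp only [dist_eq_norm]
  rw [← tendsto_zero_iff_norm_tendsto_zero]
  refine tendsto_zero_of_dense (l := atTop)
    (L := fun p : ℕ × ℕ => hA.yosidaExp p.1 t - hA.yosidaExp p.2 t) (C := 2) ?_
    hA.dense_domain ?_ x
  · intro p
    refine ContinuousLinearMap.opNorm_le_bound _ zero_le_two fun z => ?_
    refine (norm_sub_le (hA.yosidaExp p.1 t z) (hA.yosidaExp p.2 t z)).trans ?_
    have h1 := hA.norm_yosidaExp_apply_le p.1 z t.2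
    have h2 := hA.norm_yosidaExp_apply_le p.2 z t.2
    exact (add_le_add h1 h2).trans_eq (two_mul _).symm
  · intro z hz
    obtain ⟨w, hw⟩ := LinearPMap.mem_domain_iff.1 hz
    refine squeeze_zero_norm (fun p => hA.norm_yosidaExp_sub_le p.1 p.2 z t.2) ?_
    have h1 := cauchySeq_iff_tendsto_dist_atTop_0.1 (hA.tendsto_yosida hw).cauchySeq
    simp only [dist_eq_norm] at h1
    simpa using h1.mul_const (t : ℝ)

omit hA in
/-- The contraction semigroup generated by a maximal dissipative operator: the strong limit of the
semigroups of its Yosida approximations. -/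
def semigroup (hA : IsMaximalDissipative A) (t : ℝ≥0) : X →L[ℂ] X :=
  continuousLinearMapOfTendsto (hA.yosidaExp · t)
    (tendsto_pi_nhds.2 fun x => (hA.exists_tendsto_yosidaExp t x).choose_spec)

lemma tendsto_yosidaExp (t : ℝ≥0) (x : X) :
    Tendsto (fun n => hA.yosidaExp n t x) atTop (𝓝 (hA.semigroup t x)) :=
  (hA.exists_tendsto_yosidaExp t x).choose_spec

lemma norm_semigroup_le (t : ℝ≥0) (x : X) : ‖hA.semigroup t x‖ ≤ ‖x‖ :=
  le_of_tendsto (hA.tendsto_yosidaExp t x).norm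
    (Eventually.of_forall fun n => hA.norm_yosidaExp_apply_le n x t.2)

lemma semigroup_zero : hA.semigroup 0 = ContinuousLinearMap.id ℂ X := by
  ext x
  refine tendsto_nhds_unique (hA.tendsto_yosidaExp 0 x) ?_
  simp [hA.yosidaExp_zero]

lemma semigroup_add (s t : ℝ≥0) :
    hA.semigroup (s + t) = (hA.semigroup s).comp (hA.semigroup t) := by
  ext x
  refine tendsto_nhds_unique (hA.tendsto_yosidaExp (s + t) x) ?_
  simp only [NNReal.coe_add, yosidaExp_add]
  have h1 : Tendsto (fun n => hA.yosidaExp n s (hA.yosidaExp n t x - hA.semigroup t x)) atTop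
      (𝓝 0) := by
    refine squeeze_zero_norm (fun n => hA.norm_yosidaExp_apply_le n _ s.2) ?_
    rw [← tendsto_zero_iff_norm_tendsto_zero, tendsto_sub_nhds_zero_iff]
    exact hA.tendsto_yosidaExp t x
  have h2 := h1.add (hA.tendsto_yosidaExp s (hA.semigroup t x))
  simpa using h2

lemma resolvent_semigroup (n : ℕ) (t : ℝ≥0) (x : X) :
    hA.resolvent n (hA.semigroup t x) = hA.semigroup t (hA.resolvent n x) := by
  refine tendsto_nhds_unique
    (((hA.resolvent n).continuous.tendsto _).comp (hA.tendsto_yosidaExp t x)) ?_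
  convert hA.tendsto_yosidaExp t (hA.resolvent n x) using 2 with k
  exact congrArg (fun L : X →L[ℂ] X => L x) (hA.resolvent_comm_yosidaExp n k t).eq

/-- The semigroup maps the domain to itself and commutes with the operator there. -/
lemma semigroup_mem_graph (t : ℝ≥0) {x w : X} (h : (x, w) ∈ A.graph) :
    (hA.semigroup t x, hA.semigroup t w) ∈ A.graph := by
  have h1 := hA.resolvent_of_mem_graph 0 h
  have h2 := hA.resolvent_mem 0 (hA.semigroup t ((((0 : ℕ) : ℂ) + 1) • x - w))
  rw [hA.resolvent_semigroup, h1] at h2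
  convert h2 using 2
  rw [map_sub, map_smul, sub_sub_cancel]

lemma norm_semigroup_sub_le (t : ℝ≥0) {x w : X} (h : (x, w) ∈ A.graph) :
    ‖hA.semigroup t x - x‖ ≤ ‖w‖ * t := by
  refine le_of_tendsto_of_tendsto ((hA.tendsto_yosidaExp t x).sub_const x).norm
    ((hA.tendsto_yosida h).norm.mul_const (t : ℝ)) (Eventually.of_forall fun n => ?_)
  have h := norm_image_sub_le_of_norm_deriv_le_segment' (a := 0) (b := t)
    (C := ‖hA.yosida n x‖)
    (fun s _ => (hA.hasDerivAt_yosidaExp_apply n x s).hasDerivWithinAt)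
    (fun s hs => hA.norm_yosidaExp_apply_le n _ hs.1) t ⟨t.2, le_rfl⟩
  simpa [hA.yosidaExp_zero] using h

lemma tendsto_semigroup_zero (x : X) : Tendsto (fun t => hA.semigroup t x) (𝓝 0) (𝓝 x) := by
  rw [← tendsto_sub_nhds_zero_iff]
  refine tendsto_zero_of_dense (L := fun t => hA.semigroup t - 1) (C := 2) ?_
    hA.dense_domain ?_ x
  · intro t
    refine ContinuousLinearMap.opNorm_le_bound _ zero_le_two fun z => ?_
    refine (norm_sub_le (hA.semigroup t z) z).trans ?_
    linarith [hA.norm_semigroup_le t z]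
  · intro z hz
    obtain ⟨w, hw⟩ := LinearPMap.mem_domain_iff.1 hz
    refine squeeze_zero_norm (fun t => hA.norm_semigroup_sub_le t hw) ?_
    have h1 : Tendsto (fun t : ℝ≥0 => ‖w‖ * (t : ℝ)) (𝓝 0) (𝓝 (‖w‖ * ((0 : ℝ≥0) : ℝ))) :=
      (continuous_const.mul NNReal.continuous_coe).tendsto 0
    simpa using h1

lemma isContractionSemigroup : IsContractionSemigroup hA.semigroup where
  map_zero := hA.semigroup_zero
  map_add := hA.semigroup_add
  strongly_continuous := hA.tendsto_semigroup_zero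
  contraction := hA.norm_semigroup_le

lemma continuous_semigroup (x : X) : Continuous fun t => hA.semigroup t x := by
  have hle : ∀ s t : ℝ≥0, s ≤ t →
      dist (hA.semigroup t x) (hA.semigroup s x) ≤ ‖hA.semigroup (nndist t s) x - x‖ := by
    intro s t hst
    obtain ⟨r, rfl⟩ := exists_add_of_le hst
    have h1 : nndist (s + r) s = r := by
      rw [← NNReal.coe_inj, coe_nndist, NNReal.dist_eq]; simp
    rw [h1, hA.semigroup_add, dist_eq_norm]
    change ‖hA.semigroup s (hA.semigroup r x) - hA.semigroup s x‖ ≤ _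
    rw [← map_sub]
    exact hA.norm_semigroup_le _ _
  rw [continuous_iff_continuousAt]
  intro s
  rw [ContinuousAt, tendsto_iff_dist_tendsto_zero]
  refine squeeze_zero (g := fun t => ‖hA.semigroup (nndist t s) x - x‖) (fun _ => dist_nonneg)
    (fun t => ?_) ?_
  · rcases le_total s t with h | h
    · exact hle s t h
    · rw [dist_comm, nndist_comm]; exact hle t s h
  · rw [← tendsto_zero_iff_norm_tendsto_zero, tendsto_sub_nhds_zero_iff]
    have h1 : Tendsto (fun t : ℝ≥0 => nndist t s) (𝓝 s) (𝓝 0) := by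
      simpa using ((continuous_id.nndist continuous_const).tendsto s : Tendsto
        (fun t : ℝ≥0 => nndist t s) (𝓝 s) (𝓝 (nndist s s)))
    exact (hA.tendsto_semigroup_zero x).comp h1

/-- The orbit of `x`, constant for negative times. -/
def orbit (x : X) (t : ℝ) : X := hA.semigroup t.toNNReal x

lemma continuous_orbit (x : X) : Continuous (hA.orbit x) :=
  (hA.continuous_semigroup x).comp continuous_real_toNNReal

lemma orbit_zero (x : X) : hA.orbit x 0 = x := by
  rw [orbit, Real.toNNReal_zero, hA.semigroup_zero]; rfl

lemma orbit_sub_eq_integral {x w : X} (h : (x, w) ∈ A.graph) {t : ℝ} (ht : 0 ≤ t) :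
    hA.orbit x t - x = ∫ s in 0..t, hA.orbit w s := by
  have hlim : ∀ (s : ℝ) (z : X), 0 ≤ s →
      Tendsto (fun n => hA.yosidaExp n s z) atTop (𝓝 (hA.orbit z s)) := by
    intro s z hs
    have := hA.tendsto_yosidaExp s.toNNReal z
    rwa [Real.coe_toNNReal s hs] at this
  have hcont : ∀ n z, Continuous fun s => hA.yosidaExp n s z := fun n z =>
    continuous_iff_continuousAt.2 fun s => (hA.hasDerivAt_yosidaExp_apply n z s).continuousAt
  have h1 : ∀ n, ∫ s in 0..t, hA.yosidaExp n s (hA.yosida n x) = hA.yosidaExp n t x - x := by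
    intro n
    rw [intervalIntegral.integral_eq_sub_of_hasDerivAt
      (fun s _ => hA.hasDerivAt_yosidaExp_apply n x s) ((hcont n _).intervalIntegrable _ _),
      hA.yosidaExp_zero]
    rfl
  refine tendsto_nhds_unique ((hlim t x ht).sub_const x) ?_
  simp only [← h1]
  refine intervalIntegral.tendsto_integral_filter_of_dominated_convergence (fun _ => ‖w‖)
    (Eventually.of_forall fun n => (hcont n _).aestronglyMeasurable)
    (Eventually.of_forall fun n => Eventually.of_forall fun s hs => ?_)
    intervalIntegrable_const (Eventually.of_forall fun s hs => ?_)
  · rw [uIoc_of_le ht] at hs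
    refine (hA.norm_yosidaExp_apply_le n _ hs.1.le).trans ?_
    rw [hA.yosida_apply n h]
    exact hA.norm_smul_resolvent_le n w
  · rw [uIoc_of_le ht] at hs
    have h2 : Tendsto (fun n => hA.yosidaExp n s (hA.yosida n x - w)) atTop (𝓝 0) := by
      refine squeeze_zero_norm (fun n => hA.norm_yosidaExp_apply_le n _ hs.1.le) ?_
      rw [← tendsto_zero_iff_norm_tendsto_zero, tendsto_sub_nhds_zero_iff]
      exact hA.tendsto_yosida h
    simpa using h2.add (hlim s w hs.1.le)

/-- The curve `t ↦ x + ∫₀ᵗ S(s) A x ds`, defined for all real times, is continuously differentiable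
and agrees with the orbit of `x` for `t ≥ 0`. -/
lemma hasDerivAt_integral_orbit (x w : X) (t : ℝ) :
    HasDerivAt (fun t => x + ∫ s in 0..t, hA.orbit w s) (hA.orbit w t) t :=
  (intervalIntegral.integral_hasDerivAt_right ((hA.continuous_orbit w).intervalIntegrable _ _)
    ((hA.continuous_orbit w).stronglyMeasurableAtFilter _ _)
    (hA.continuous_orbit w).continuousAt).const_add x

lemma hasDerivWithinAt_orbit {x w : X} (h : (x, w) ∈ A.graph) {t : ℝ} (ht : 0 ≤ t) :
    HasDerivWithinAt (hA.orbit x) (hA.orbit w t) (Ici 0) t := by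
  refine (hA.hasDerivAt_integral_orbit x w t).hasDerivWithinAt.congr (fun s hs => ?_) ?_
  · rw [← hA.orbit_sub_eq_integral h hs, add_sub_cancel]
  · rw [← hA.orbit_sub_eq_integral h ht, add_sub_cancel]

lemma isGenerator : IsGenerator A hA.semigroup := by
  have hfwd : ∀ x w, (x, w) ∈ A.graph →
      Tendsto (fun t : ℝ≥0 => (t : ℝ)⁻¹ • (hA.semigroup t x - x)) (𝓝[>] 0) (𝓝 w) := by
    intro x w h
    have h1 := hA.hasDerivWithinAt_orbit h le_rfl
    rw [hasDerivWithinAt_iff_tendsto_slope] at h1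
    have h2 : Tendsto (fun t : ℝ≥0 => (t : ℝ)) (𝓝[>] 0) (𝓝[Ici 0 \ {0}] 0) := by
      refine tendsto_nhdsWithin_iff.2 ⟨?_, ?_⟩
      · exact (NNReal.continuous_coe.tendsto' 0 0 rfl).mono_left nhdsWithin_le_nhds
      · filter_upwards [self_mem_nhdsWithin] with t ht
        exact ⟨t.2, by simpa using (ne_of_gt ht)⟩
    have h3 := h1.comp h2
    rw [hA.orbit_zero] at h3
    refine h3.congr fun t => ?_
    simp only [Function.comp, slope_def_module, hA.orbit_zero, sub_zero]
    rw [orbit, Real.toNNReal_coe]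
  intro x z
  refine ⟨hfwd x z, fun h => ?_⟩
  -- the solution of `(1 - A) y = x - z` is `x`, since the derivative of the semigroup is dissipative
  have hy := hA.resolvent_mem 0 (x - z)
  set y := hA.resolvent 0 (x - z)
  have hlim := h.sub (hfwd _ _ hy)
  have hzero : (inner ℂ (z - ((((0 : ℕ) : ℂ) + 1) • y - (x - z))) (x - y)).re ≤ 0 := by
    have h1 : Tendsto (fun t : ℝ≥0 => (inner ℂ ((t : ℝ)⁻¹ • (hA.semigroup t x - x) -
        (t : ℝ)⁻¹ • (hA.semigroup t y - y)) (x - y)).re) (𝓝[>] 0)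
        (𝓝 (inner ℂ (z - ((((0 : ℕ) : ℂ) + 1) • y - (x - z))) (x - y)).re) :=
      (Complex.continuous_re.tendsto _).comp (hlim.inner tendsto_const_nhds)
    refine le_of_tendsto h1 (Eventually.of_forall fun t => ?_)
    rw [← smul_sub, sub_sub_sub_comm, ← map_sub, ← Complex.coe_smul, inner_smul_left,
      Complex.conj_ofReal, Complex.re_ofReal_mul, inner_sub_left, Complex.sub_re]
    have h2 : (inner ℂ (hA.semigroup t (x - y)) (x - y)).re ≤ _ :=
      re_inner_le_norm (𝕜 := ℂ) _ _
    have h3 : (inner ℂ (x - y) (x - y)).re = ‖x - y‖ ^ 2 := inner_self_eq_norm_sq (𝕜 := ℂ) _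
    have h4 := hA.norm_semigroup_le t (x - y)
    refine mul_nonpos_of_nonneg_of_nonpos (inv_nonneg.2 t.2) ?_
    rw [h3]
    nlinarith [norm_nonneg (x - y)]
  have h5 : z - ((((0 : ℕ) : ℂ) + 1) • y - (x - z)) = x - y := by
    rw [Nat.cast_zero, zero_add, one_smul]; abel
  have h6 : (inner ℂ (x - y) (x - y)).re = ‖x - y‖ ^ 2 := inner_self_eq_norm_sq (𝕜 := ℂ) _
  rw [h5, h6] at hzero
  have hxy : x = y := by
    rw [← sub_eq_zero, ← norm_eq_zero]
    nlinarith [norm_nonneg (x - y)]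
  rw [← hxy] at hy
  convert hy using 2
  rw [Nat.cast_zero, zero_add, one_smul, sub_sub_cancel]

/-- With `R = (1 - A)⁻¹` and `w = ∫₀ᵗ S(s) x ds`, the identity `w = R (w - (S(t) x - x))` shows that
`w` lies in the domain and `A w = S(t) x - x`. -/
lemma isMildSolution (x : X) : IsMildSolution A x (hA.orbit x) where
  continuousOn := (hA.continuous_orbit x).continuousOn
  integral_eq t ht := by
    set w := ∫ s in 0..t, hA.orbit x s with hw
    set y := hA.resolvent 0 x with hy
    have hR : ∀ s, hA.orbit y s = hA.resolvent 0 (hA.orbit x s) := fun s =>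
      (hA.resolvent_semigroup 0 _ x).symm
    have hgr : (y, y - x) ∈ A.graph := by
      have := hA.resolvent_mem 0 x
      rwa [Nat.cast_zero, zero_add, one_smul] at this
    have h1 := hA.orbit_sub_eq_integral hgr ht
    have h2 : ∀ s, hA.orbit (y - x) s = hA.resolvent 0 (hA.orbit x s) - hA.orbit x s := by
      intro s
      rw [← hR, orbit, map_sub]; rfl
    simp only [h2] at h1
    have hRc : Continuous fun s => hA.resolvent 0 (hA.orbit x s) :=
      (hA.resolvent 0).continuous.comp (hA.continuous_orbit x)
    rw [intervalIntegral.integral_sub (hRc.intervalIntegrable _ _)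
      ((hA.continuous_orbit x).intervalIntegrable _ _),
      ContinuousLinearMap.intervalIntegral_comp_comm _
        ((hA.continuous_orbit x).intervalIntegrable _ _), hR, hy, ← hw, ← map_sub] at h1
    have h3 : hA.resolvent 0 (w - (hA.orbit x t - x)) = w := by
      rw [map_sub, h1, sub_sub_cancel]
    have h4 := hA.resolvent_mem 0 (w - (hA.orbit x t - x))
    rw [h3] at h4
    convert h4 using 2
    rw [Nat.cast_zero, zero_add, one_smul, sub_sub_cancel]

/-- The integral `w` of the difference of two mild solutions satisfies `w' = A w` and `w(0) = 0`. -/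
lemma isMildSolution_unique {x : X} {y z : ℝ → X} (hy : IsMildSolution A x y)
    (hz : IsMildSolution A x z) : EqOn z y (Ici 0) := by
  have hc : ContinuousOn (fun s => z s - y s) (Ici 0) := hz.continuousOn.sub hy.continuousOn
  have hint : ∀ {f : ℝ → X}, ContinuousOn f (Ici 0) → ∀ {t : ℝ}, 0 ≤ t →
      IntervalIntegrable f volume 0 t := fun hf t ht =>
    (hf.mono (by rw [uIcc_of_le ht]; exact Icc_subset_Ici_self)).intervalIntegrable
  have hgr : ∀ t, 0 ≤ t → (∫ s in 0..t, (z s - y s), z t - y t) ∈ A.graph := by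
    intro t ht
    convert A.graph.sub_mem (hz.integral_eq t ht) (hy.integral_eq t ht) using 1
    rw [intervalIntegral.integral_sub (hint hz.continuousOn ht) (hint hy.continuousOn ht),
      Prod.mk_sub_mk, sub_sub_sub_cancel_right]
  have hd : ∀ t, 0 < t → HasDerivAt (fun t => ∫ s in 0..t, (z s - y s)) (z t - y t) t := by
    intro t ht
    have hct : ContinuousAt (fun s => z s - y s) t := hc.continuousAt (Ici_mem_nhds ht)
    refine intervalIntegral.integral_hasDerivAt_right (hint hc ht.le) ?_ hct
    exact ContinuousOn.stronglyMeasurableAtFilter isOpen_Ioi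
      (hc.mono Ioi_subset_Ici_self) t ht
  have hcw : ContinuousOn (fun t => ∫ s in 0..t, (z s - y s)) (Ici 0) := by
    intro t ht
    have h1 := intervalIntegral.continuousOn_primitive_interval
      (f := fun s => z s - y s) (μ := volume) (a := 0) (b := t + 1) (by
        rw [uIcc_of_le (by linarith [mem_Ici.1 ht])]
        exact (hc.mono Icc_subset_Ici_self).integrableOn_Icc)
    rw [uIcc_of_le (by linarith [mem_Ici.1 ht])] at h1
    refine (h1 t ⟨ht, by linarith⟩).mono_of_mem_nhdsWithin ?_
    rw [mem_nhdsWithin]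
    exact ⟨Iio (t + 1), isOpen_Iio, by simp, fun s hs => ⟨hs.2, hs.1.le⟩⟩
  intro t ht
  have h0 := norm_le_of_re_inner_nonpos hcw hd
    (fun t ht => hA.re_inner_nonpos (hgr t ht.le)) ht
  have h1 := hgr t ht
  rw [intervalIntegral.integral_same, norm_zero, norm_le_zero_iff] at h0
  exact sub_eq_zero.1 (A.graph_fst_eq_zero_snd h1 h0)

lemma isClassicalSolution {x : X} (hx : x ∈ A.domain) : IsClassicalSolution A x (hA.orbit x) := by
  obtain ⟨w, hw⟩ := LinearPMap.mem_domain_iff.1 hx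
  have hgr : ∀ t, (hA.orbit x t, hA.orbit w t) ∈ A.graph := fun t => hA.semigroup_mem_graph _ hw
  have hval : ∀ t (h : hA.orbit x t ∈ A.domain), A ⟨_, h⟩ = hA.orbit w t := fun t h =>
    (LinearPMap.mem_graph_snd_inj A (hgr t) (A.mem_graph ⟨_, h⟩) rfl).symm
  refine ⟨hA.orbit_zero x, fun t _ => LinearPMap.mem_domain_of_mem_graph (hgr t), ?_, ?_, ?_⟩
  · simp only [hval]
    exact ((hA.continuous_orbit x).comp continuous_subtype_val).prodMk
      ((hA.continuous_orbit w).comp continuous_subtype_val)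
  · have h1 : ContDiff ℝ 1 (fun t => x + ∫ s in 0..t, hA.orbit w s) := by
      rw [contDiff_one_iff_deriv]
      refine ⟨fun t => (hA.hasDerivAt_integral_orbit x w t).differentiableAt, ?_⟩
      rw [funext fun t => (hA.hasDerivAt_integral_orbit x w t).deriv]
      exact hA.continuous_orbit w
    refine h1.contDiffOn.congr fun t ht => ?_
    rw [← hA.orbit_sub_eq_integral hw ht, add_sub_cancel]
  · intro t ht
    rw [hval]
    exact hA.hasDerivWithinAt_orbit hw ht

end IsMaximalDissipative

end LumerPhillips

/-! ### Primitives and traces on an interval -/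

section Interval

variable {ℓ : ℝ}

/-- The class of the constant function `1`. -/
def one (ℓ : ℝ) : L2I ℓ :=
  indicatorConstLp 2 MeasurableSet.univ (measure_ne_top (volume.restrict (Ioo 0 ℓ)) univ) (1 : ℂ)

lemma coeFn_one (ℓ : ℝ) : one ℓ =ᵐ[volume.restrict (Ioo 0 ℓ)] fun _ => 1 := by
  refine indicatorConstLp_coeFn.trans (Eventually.of_forall fun x => ?_)
  simp

lemma inner_one (g : L2I ℓ) : inner ℂ (one ℓ) g = ∫ x in Ioo 0 ℓ, g x := by
  rw [one, L2.inner_indicatorConstLp_one, Measure.restrict_univ]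

lemma norm_prim_le (hℓ : 0 < ℓ) (g : L2I ℓ) {x : ℝ} (hx : x ∈ Ioo 0 ℓ) :
    ‖prim g x‖ ≤ √ℓ * ‖g‖ := by
  have hfin : (volume.restrict (Ioo 0 ℓ)) (Iio x) ≠ ⊤ := measure_ne_top _ _
  have h1 : prim g x = inner ℂ (indicatorConstLp 2 measurableSet_Iio hfin (1 : ℂ)) g := by
    rw [prim_eq hx, L2.inner_indicatorConstLp_one, ← integral_indicator measurableSet_Iio]
    congr 1
  rw [h1]
  refine (norm_inner_le_norm _ _).trans (mul_le_mul_of_nonneg_right ?_ (norm_nonneg g))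
  refine norm_indicatorConstLp_le.trans ?_
  rw [norm_one, one_mul, Real.sqrt_eq_rpow]
  simp only [ENNReal.toReal_ofNat]
  refine Real.rpow_le_rpow measureReal_nonneg ?_ (by norm_num)
  refine (measureReal_mono (subset_univ _)).trans ?_
  rw [measureReal_restrict_apply_univ, Real.volume_real_Ioo_of_le hℓ.le, sub_zero]

lemma prim_congr_ae {g g' : ℝ → ℂ} (h : g =ᵐ[volume.restrict (Ioo 0 ℓ)] g') {x : ℝ}
    (hx : x ∈ Icc 0 ℓ) : prim g x = prim g' x := by
  rw [prim, prim, intervalIntegral.integral_of_le hx.1, intervalIntegral.integral_of_le hx.1,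
    integral_Ioc_eq_integral_Ioo, integral_Ioc_eq_integral_Ioo]
  exact integral_congr_ae (ae_restrict_of_ae_restrict_of_subset (Ioo_subset_Ioo_right hx.2) h)

lemma memLp_prim (hℓ : 0 < ℓ) (g : L2I ℓ) : MemLp (prim g) 2 (volume.restrict (Ioo 0 ℓ)) := by
  refine MemLp.of_bound (((prim_continuousOn hℓ g.integrable).mono
    Ioo_subset_Icc_self).aestronglyMeasurable measurableSet_Ioo) (√ℓ * ‖g‖) ?_
  filter_upwards [ae_restrict_mem measurableSet_Ioo] with x hx
  exact norm_prim_le hℓ g hx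

lemma L2I.intervalIntegrable (g : L2I ℓ) {x : ℝ} (hx : x ∈ Icc 0 ℓ) :
    IntervalIntegrable g volume 0 x := by
  rw [intervalIntegrable_iff_integrableOn_Ioo_of_le hx.1]
  exact IntegrableOn.mono_set (t := Ioo 0 ℓ) g.integrable (Ioo_subset_Ioo_right hx.2)

open Classical in
/-- The operator on `L²(0,ℓ)` that maps a function to its primitive vanishing at `0`; it is `0` for
`ℓ ≤ 0`. -/
def primL (ℓ : ℝ) : L2I ℓ →L[ℂ] L2I ℓ :=
  if hℓ : 0 < ℓ then
    LinearMap.mkContinuous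
      { toFun := fun g => (memLp_prim hℓ g).toLp (prim g)
        map_add' := fun f g => by
          rw [← MemLp.toLp_add, MemLp.toLp_eq_toLp_iff]
          filter_upwards [ae_restrict_mem measurableSet_Ioo] with x hx
          have hx' := Ioo_subset_Icc_self hx
          rw [Pi.add_apply, prim_congr_ae (Lp.coeFn_add f g) hx', prim, prim, prim,
            ← intervalIntegral.integral_add (f.intervalIntegrable hx') (g.intervalIntegrable hx')]
          rfl
        map_smul' := fun c g => by
          rw [← MemLp.toLp_const_smul, MemLp.toLp_eq_toLp_iff]
          filter_upwards [ae_restrict_mem measurableSet_Ioo] with x hx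
          rw [prim_congr_ae (Lp.coeFn_smul c g) (Ioo_subset_Icc_self hx), prim, Pi.smul_apply, prim,
            ← intervalIntegral.integral_smul]
          rfl }
      (measureUnivNNReal (volume.restrict (Ioo (0 : ℝ) ℓ)) ^ (2 : ENNReal).toReal⁻¹ * √ℓ)
      fun g => by
        rw [mul_assoc]
        refine Lp.norm_le_of_ae_bound (by positivity) ?_
        filter_upwards [ae_restrict_mem measurableSet_Ioo, (memLp_prim hℓ g).coeFn_toLp] with x hx h
        change ‖(memLp_prim hℓ g).toLp (prim g) x‖ ≤ _
        rw [h]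
        exact norm_prim_le hℓ g hx
  else 0

lemma coeFn_primL (hℓ : 0 < ℓ) (g : L2I ℓ) :
    primL ℓ g =ᵐ[volume.restrict (Ioo 0 ℓ)] prim g := by
  rw [primL, dif_pos hℓ]
  exact (memLp_prim hℓ g).coeFn_toLp

lemma contRep_primL (hℓ : 0 < ℓ) (g : L2I ℓ) : IsContRep (primL ℓ g) (prim g) :=
  ⟨prim_continuousOn hℓ g.integrable, coeFn_primL hℓ g⟩

lemma contRep_one : IsContRep (one ℓ) (fun _ => 1) := ⟨continuousOn_const, coeFn_one ℓ⟩

lemma IsWeakDeriv.comp {j k : ℕ} {f g h : L2I ℓ} (hg : IsWeakDeriv k f g)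
    (hh : IsWeakDeriv j g h) : IsWeakDeriv (k + j) f h := by
  intro φ hφ
  have e : _root_.iteratedDeriv (k + j) φ = _root_.iteratedDeriv k (_root_.iteratedDeriv j φ) := by
    simp only [iteratedDeriv_eq_iterate, Function.iterate_add_apply]
  rw [e, hg _ (hφ.iteratedDeriv j), hh φ hφ, pow_add, mul_assoc]

lemma isWeakDeriv_primL (hℓ : 0 < ℓ) (g : L2I ℓ) : IsWeakDeriv 1 (primL ℓ g) g := by
  intro φ hφ
  rw [iteratedDeriv_one, pow_one, neg_one_mul, ← prim_test g.integrable hφ]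
  apply integral_congr_ae
  filter_upwards [coeFn_primL hℓ g] with x hx
  rw [hx]

lemma isWeakDeriv_one (hℓ : 0 < ℓ) : IsWeakDeriv 1 (one ℓ) 0 := by
  intro φ hφ
  have h1 : ∫ x in Ioo 0 ℓ, φ x • (0 : L2I ℓ) x = 0 := by
    refine integral_eq_zero_of_ae ?_
    filter_upwards [Lp.coeFn_zero ℂ 2 (volume.restrict (Ioo 0 ℓ))] with x hx
    rw [hx]; simp
  have h2 : ∫ x in Ioo 0 ℓ, deriv φ x = 0 := by
    rw [← integral_Ioc_eq_integral_Ioo, ← intervalIntegral.integral_of_le hℓ.le,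
      intervalIntegral.integral_deriv_eq_sub]
    · rw [image_eq_zero_of_notMem_tsupport (fun hh => lt_irrefl _ (hφ.supp hh).2),
        image_eq_zero_of_notMem_tsupport (fun hh => lt_irrefl _ (hφ.supp hh).1), sub_zero]
    · intro x _; exact (hφ.smooth.differentiable (by simp)).differentiableAt
    · exact hφ.deriv.smooth.continuous.intervalIntegrable _ _
  rw [h1, mul_zero, iteratedDeriv_one]
  have h3 : ∫ x in Ioo 0 ℓ, deriv φ x • (one ℓ) x = ∫ x in Ioo 0 ℓ, deriv φ x • (1 : ℂ) := by
    apply integral_congr_ae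
    filter_upwards [coeFn_one ℓ] with x hx
    rw [hx]
  rw [h3, integral_smul_const, h2, zero_smul]

/-- The function with derivative `g` and value `c` at `0`. -/
def fromDeriv (c : ℂ) (g : L2I ℓ) : L2I ℓ := c • one ℓ + primL ℓ g

lemma contRep_fromDeriv (hℓ : 0 < ℓ) (c : ℂ) (g : L2I ℓ) :
    IsContRep (fromDeriv c g) (fun x => c + prim g x) := by
  have h := (contRep_one (ℓ := ℓ)).smul c |>.add (contRep_primL hℓ g)
  have e : (fun x => c + prim g x) = (c • fun _ => 1) + prim g := by
    ext x
    simp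
  rw [e]
  exact h

lemma isWeakDeriv_fromDeriv (hℓ : 0 < ℓ) (c : ℂ) (g : L2I ℓ) :
    IsWeakDeriv 1 (fromDeriv c g) g := by
  simpa [fromDeriv] using ((isWeakDeriv_one hℓ).smul c).add (isWeakDeriv_primL hℓ g)

lemma trace_fromDeriv_zero (hℓ : 0 < ℓ) (c : ℂ) (g : L2I ℓ) : trace (fromDeriv c g) 0 = c := by
  rw [(contRep_fromDeriv hℓ c g).trace_eq hℓ ⟨le_rfl, hℓ.le⟩, prim,
    intervalIntegral.integral_same, add_zero]

lemma trace_fromDeriv_length (hℓ : 0 < ℓ) (c : ℂ) (g : L2I ℓ) :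
    trace (fromDeriv c g) ℓ = c + inner ℂ (one ℓ) g := by
  rw [(contRep_fromDeriv hℓ c g).trace_eq hℓ ⟨hℓ.le, le_rfl⟩, inner_one, prim,
    intervalIntegral.integral_of_le hℓ.le, integral_Ioc_eq_integral_Ioo]

lemma IsWeakDeriv.eq_fromDeriv (hℓ : 0 < ℓ) {f g : L2I ℓ} (h : IsWeakDeriv 1 f g) :
    f = fromDeriv (trace f 0) g := by
  obtain ⟨c, hc⟩ := h.exists_contRep hℓ
  have h1 : f = fromDeriv c g := Lp.ext (hc.2.trans (contRep_fromDeriv hℓ c g).2.symm)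
  conv_rhs => rw [h1, trace_fromDeriv_zero hℓ]
  exact h1

/-- Fubini's theorem on the square: the two triangles give the whole square. -/
lemma inner_primL_add_inner_primL (hℓ : 0 < ℓ) (p q : L2I ℓ) :
    inner ℂ (primL ℓ p) q + inner ℂ p (primL ℓ q) =
      conj (inner ℂ (one ℓ) p) * inner ℂ (one ℓ) q := by
  set μ := volume.restrict (Ioo 0 ℓ) with hμ
  have hp : Integrable (fun x => conj (p x)) μ :=
    Complex.conjLIE.integrable_comp_iff.2 p.integrable
  have hi : Integrable (fun z : ℝ × ℝ => conj (p z.1) * q z.2) (μ.prod μ) :=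
    hp.mul_prod q.integrable
  have hi1 := hi.indicator (s := {z : ℝ × ℝ | z.1 < z.2})
    (measurableSet_lt measurable_fst measurable_snd)
  have hi2 := hi.indicator (s := {z : ℝ × ℝ | z.2 < z.1})
    (measurableSet_lt measurable_snd measurable_fst)
  have e1 : inner ℂ p (primL ℓ q) =
      ∫ z, {z : ℝ × ℝ | z.2 < z.1}.indicator (fun z => conj (p z.1) * q z.2) z ∂(μ.prod μ) := by
    rw [integral_prod _ hi2, L2.inner_def]
    apply integral_congr_ae
    filter_upwards [coeFn_primL hℓ q, ae_restrict_mem measurableSet_Ioo] with x hx hxm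
    rw [hx, prim_eq hxm, RCLike.inner_apply', ← integral_const_mul]
    congr 1
    ext t
    simp [indicator]
  have e2 : inner ℂ (primL ℓ p) q =
      ∫ z, {z : ℝ × ℝ | z.1 < z.2}.indicator (fun z => conj (p z.1) * q z.2) z ∂(μ.prod μ) := by
    rw [integral_prod_symm _ hi1, L2.inner_def]
    apply integral_congr_ae
    filter_upwards [coeFn_primL hℓ p, ae_restrict_mem measurableSet_Ioo] with x hx hxm
    rw [hx, prim_eq hxm, RCLike.inner_apply', ← integral_conj, ← integral_mul_const]
    congr 1
    ext t
    by_cases h : t < x <;> simp [h]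
  have e3 : conj (inner ℂ (one ℓ) p) * inner ℂ (one ℓ) q =
      ∫ z, conj (p z.1) * q z.2 ∂(μ.prod μ) := by
    rw [integral_prod_mul (fun x => conj (p x)) q, inner_one, inner_one, ← integral_conj]
  rw [e1, e2, e3, ← integral_add hi1 hi2]
  apply integral_congr_ae
  have hdiag : ∀ᵐ z ∂(μ.prod μ), z.1 ≠ z.2 := by
    rw [Measure.ae_prod_iff_ae_ae]
    · refine Eventually.of_forall fun x => ?_
      have : ∀ᵐ y ∂μ, y ≠ x := by simp [ae_iff]
      filter_upwards [this] with y hy using hy.symm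
    · exact (measurableSet_eq_fun measurable_fst measurable_snd).compl
  filter_upwards [hdiag] with z hz
  rcases lt_or_gt_of_ne hz with h | h
  · simp [indicator, h, h.le]
  · simp [indicator, h, h.le]

/-- Integration by parts. -/
lemma IsWeakDeriv.inner_add_inner (hℓ : 0 < ℓ) {f f' g g' : L2I ℓ} (hf : IsWeakDeriv 1 f f')
    (hg : IsWeakDeriv 1 g g') :
    inner ℂ f' g + inner ℂ f g' =
      conj (trace f ℓ) * trace g ℓ - conj (trace f 0) * trace g 0 := by
  rw [hf.eq_fromDeriv hℓ, hg.eq_fromDeriv hℓ]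
  simp only [trace_fromDeriv_zero hℓ, trace_fromDeriv_length hℓ]
  simp only [fromDeriv, inner_add_left, inner_add_right, inner_smul_left, inner_smul_right, map_add]
  have h := inner_primL_add_inner_primL hℓ f' g'
  have h1 : inner ℂ f' (one ℓ) = conj (inner ℂ (one ℓ) f') := (inner_conj_symm _ _).symm
  rw [h1]
  linear_combination h

lemma inner_one_one (hℓ : 0 < ℓ) : inner ℂ (one ℓ) (one ℓ) = (ℓ : ℂ) := by
  rw [inner_one, integral_congr_ae (coeFn_one ℓ)]
  simp [hℓ.le]

lemma coeFn_primL_one (hℓ : 0 < ℓ) :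
    primL ℓ (one ℓ) =ᵐ[volume.restrict (Ioo 0 ℓ)] fun x => (x : ℂ) := by
  filter_upwards [coeFn_primL hℓ (one ℓ), ae_restrict_mem measurableSet_Ioo] with x hx hxm
  rw [hx, prim_congr_ae (coeFn_one ℓ) (Ioo_subset_Icc_self hxm), prim]
  simp

lemma coeFn_primL_primL_one (hℓ : 0 < ℓ) :
    primL ℓ (primL ℓ (one ℓ)) =ᵐ[volume.restrict (Ioo 0 ℓ)] fun x => (x : ℂ) ^ 2 / 2 := by
  filter_upwards [coeFn_primL hℓ (primL ℓ (one ℓ)), ae_restrict_mem measurableSet_Ioo] with x hx hxm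
  rw [hx, prim_congr_ae (coeFn_primL_one hℓ) (Ioo_subset_Icc_self hxm), prim,
    intervalIntegral.integral_ofReal, integral_id]
  push_cast
  ring

lemma inner_one_primL_one (hℓ : 0 < ℓ) : inner ℂ (one ℓ) (primL ℓ (one ℓ)) = (ℓ : ℂ) ^ 2 / 2 := by
  rw [inner_one, integral_congr_ae (coeFn_primL_one hℓ), ← integral_Ioc_eq_integral_Ioo,
    ← intervalIntegral.integral_of_le hℓ.le, intervalIntegral.integral_ofReal, integral_id]
  push_cast
  ring

lemma inner_one_primL_primL_one (hℓ : 0 < ℓ) :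
    inner ℂ (one ℓ) (primL ℓ (primL ℓ (one ℓ))) = (ℓ : ℂ) ^ 3 / 6 := by
  have h : ∀ x : ℝ, (x : ℂ) ^ 2 / 2 = ((x ^ 2 / 2 : ℝ) : ℂ) := fun x => by push_cast; rfl
  rw [inner_one, integral_congr_ae (coeFn_primL_primL_one hℓ), ← integral_Ioc_eq_integral_Ioo,
    ← intervalIntegral.integral_of_le hℓ.le]
  simp only [h]
  rw [intervalIntegral.integral_ofReal, intervalIntegral.integral_div, integral_pow]
  push_cast
  ring

/-- Hermite interpolation: values and slopes at both ends can be prescribed. -/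
lemma exists_hermite (hℓ : 0 < ℓ) (a b s t : ℂ) : ∃ g : L2I ℓ,
    trace (fromDeriv a (fromDeriv s g)) ℓ = b ∧ trace (fromDeriv s g) ℓ = t := by
  have hne : (ℓ : ℂ) ≠ 0 := Complex.ofReal_ne_zero.2 hℓ.ne'
  -- the second derivative of the interpolating cubic is `A + B x`
  set p := t - s with hp
  set q := b - a - s * ℓ with hq
  refine ⟨((6 * q - 2 * p * ℓ) / ℓ ^ 2) • one ℓ +
    ((6 * p * ℓ - 12 * q) / ℓ ^ 3) • primL ℓ (one ℓ), ?_, ?_⟩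
  · rw [trace_fromDeriv_length hℓ]
    simp only [fromDeriv, map_add, map_smul, inner_add_right, inner_smul_right, inner_one_one hℓ,
      inner_one_primL_one hℓ, inner_one_primL_primL_one hℓ]
    field_simp
    rw [hq]
    ring
  · rw [trace_fromDeriv_length hℓ]
    simp only [inner_add_right, inner_smul_right, inner_one_one hℓ, inner_one_primL_one hℓ]
    field_simp
    rw [hp]
    ring

/-- If `⟨m, w'⟩ = -⟨g, w⟩` for all `w` vanishing at both ends, then `m' = g`. -/
lemma exists_eq_fromDeriv (hℓ : 0 < ℓ) {m g : L2I ℓ}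
    (h : ∀ k : L2I ℓ, inner ℂ (one ℓ) k = 0 → inner ℂ m k = -inner ℂ g (primL ℓ k)) :
    ∃ c, m = fromDeriv c g := by
  have h1 : m - primL ℓ g ∈ (ℂ ∙ one ℓ)ᗮᗮ := by
    rw [Submodule.mem_orthogonal']
    intro k hk
    rw [Submodule.mem_orthogonal_singleton_iff_inner_right] at hk
    have := inner_primL_add_inner_primL hℓ g k
    rw [hk, mul_zero] at this
    rw [inner_sub_left, h k hk]
    linear_combination -this
  rw [Submodule.orthogonal_orthogonal, Submodule.mem_span_singleton] at h1
  obtain ⟨c, hc⟩ := h1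
  exact ⟨c, by rw [fromDeriv, hc, sub_add_cancel]⟩

/-- If `⟨m, w''⟩ = -⟨g, w⟩` for all `w` vanishing to second order at both ends, then `m'' = -g`. -/
lemma exists_eq_fromDeriv_fromDeriv (hℓ : 0 < ℓ) {m g : L2I ℓ}
    (h : ∀ k : L2I ℓ, inner ℂ (one ℓ) k = 0 → inner ℂ (one ℓ) (primL ℓ k) = 0 →
      inner ℂ m k = -inner ℂ g (primL ℓ (primL ℓ k))) :
    ∃ c s, m = fromDeriv c (fromDeriv s (-g)) := by
  have h1 : m + primL ℓ (primL ℓ g) ∈ (Submodule.span ℂ {one ℓ, primL ℓ (one ℓ)})ᗮᗮ := by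
    rw [Submodule.mem_orthogonal']
    intro k hk
    rw [Submodule.mem_orthogonal] at hk
    have k1 := hk (one ℓ) (Submodule.subset_span (by simp))
    have k2 := hk (primL ℓ (one ℓ)) (Submodule.subset_span (by simp))
    have e0 := inner_primL_add_inner_primL hℓ (one ℓ) k
    rw [k1, k2, mul_zero, zero_add] at e0
    have e1 := inner_primL_add_inner_primL hℓ (primL ℓ g) k
    have e2 := inner_primL_add_inner_primL hℓ g (primL ℓ k)
    rw [k1, mul_zero] at e1
    rw [e0, mul_zero] at e2
    rw [inner_add_left, h k k1 e0]
    linear_combination e1 - e2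
  have hfin : FiniteDimensional ℂ (Submodule.span ℂ {one ℓ, primL ℓ (one ℓ)}) :=
    FiniteDimensional.span_of_finite ℂ (by simp)
  rw [Submodule.orthogonal_orthogonal, Submodule.mem_span_pair] at h1
  obtain ⟨c, s, hc⟩ := h1
  refine ⟨c, s, ?_⟩
  rw [fromDeriv, fromDeriv, map_add, map_smul, ← add_assoc, hc, map_neg, map_neg]
  abel

end Interval

lemma mem_Sobolev_zero {ℓ : ℝ} (f : L2I ℓ) : f ∈ Sobolev ℓ 0 := fun k hk =>
  ⟨f, by rw [Nat.le_zero.1 hk]; exact fun φ _ => by simp⟩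

lemma IsWeakDeriv.mem_Sobolev_succ {ℓ : ℝ} {m : ℕ} {f g : L2I ℓ} (h : IsWeakDeriv 1 f g)
    (hg : g ∈ Sobolev ℓ m) : f ∈ Sobolev ℓ (m + 1) := by
  intro k hk
  rcases Nat.eq_zero_or_pos k with rfl | hpos
  · exact ⟨f, fun φ _ => by simp⟩
  · obtain ⟨j, rfl⟩ := Nat.exists_eq_add_of_le hpos
    obtain ⟨p, hp⟩ := hg j (by omega)
    exact ⟨p, h.comp hp⟩

namespace Network

section Poincare

variable {V E : Type*} (T : Network V E)

/-! ### The Poincaré inequality and completeness of the energy space -/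

/-- Parameters of a function on the network: on each edge, the derivative of highest order in the
energy, the value at `0`, and the slope at `0` (relevant on beams only). -/
abbrev Param : Type _ := T.L2 × (E → ℂ) × (E → ℂ)

/-- The function on the network with the given parameters. -/
def lift (x : T.Param) (e : E) : L2I (T.length e) :=
  match T.kind e with
  | .string => fromDeriv (x.2.1 e) (x.1 e)
  | .beam => fromDeriv (x.2.1 e) (fromDeriv (x.2.2 e) (x.1 e))

variable {T}

lemma lift_string {e : E} (he : T.kind e = .string) (x : T.Param) :
    T.lift x e = fromDeriv (x.2.1 e) (x.1 e) := by
  rw [lift, he]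

lemma lift_beam {e : E} (he : T.kind e = .beam) (x : T.Param) :
    T.lift x e = fromDeriv (x.2.1 e) (fromDeriv (x.2.2 e) (x.1 e)) := by
  rw [lift, he]

lemma isWeakDeriv_lift (x : T.Param) (e : E) :
    IsWeakDeriv (T.kind e).order (T.lift x e) (x.1 e) := by
  have hℓ := T.length_pos e
  cases he : T.kind e
  · rw [lift_string he]
    exact isWeakDeriv_fromDeriv hℓ _ _
  · rw [lift_beam he]
    exact (isWeakDeriv_fromDeriv hℓ _ _).comp (isWeakDeriv_fromDeriv hℓ _ _)

lemma lift_mem_Sobolev (x : T.Param) (e : E) :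
    T.lift x e ∈ Sobolev (T.length e) (T.kind e).order := by
  have hℓ := T.length_pos e
  cases he : T.kind e
  · rw [lift_string he]
    exact (isWeakDeriv_fromDeriv hℓ _ _).mem_Sobolev_succ (mem_Sobolev_zero _)
  · rw [lift_beam he]
    exact (isWeakDeriv_fromDeriv hℓ _ _).mem_Sobolev_succ
      ((isWeakDeriv_fromDeriv hℓ _ _).mem_Sobolev_succ (mem_Sobolev_zero _))

lemma lift_add (x y : T.Param) : T.lift (x + y) = T.lift x + T.lift y := by
  funext e
  rw [Pi.add_apply]
  cases he : T.kind e
  · simp only [lift_string he, fromDeriv, Prod.snd_add, Prod.fst_add, Pi.add_apply, map_add, add_smul]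
    abel
  · simp only [lift_beam he, fromDeriv, Prod.snd_add, Prod.fst_add, Pi.add_apply, map_add, add_smul]
    abel

lemma lift_smul (a : ℂ) (x : T.Param) : T.lift (a • x) = a • T.lift x := by
  funext e
  rw [Pi.smul_apply]
  cases he : T.kind e
  · simp only [lift_string he, fromDeriv, Prod.smul_snd, Prod.smul_fst, Pi.smul_apply, map_smul,
      smul_add, smul_assoc]
  · simp only [lift_beam he, fromDeriv, Prod.smul_snd, Prod.smul_fst, Pi.smul_apply, map_smul,
      map_add, smul_add, smul_assoc]

@[fun_prop]
lemma continuous_fromDeriv {ℓ : ℝ} {Y : Type*} [TopologicalSpace Y] {c : Y → ℂ} {g : Y → L2I ℓ}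
    (hc : Continuous c) (hg : Continuous g) : Continuous fun y => fromDeriv (c y) (g y) :=
  (hc.smul continuous_const).add ((primL ℓ).continuous.comp hg)

lemma nodeVal_term (k : ℕ) (f : T.L2) (e : E) :
    T.nodeVal k f e (T.term e) = trace (weakDeriv k (f e)) (T.length e) := by
  rw [nodeVal, coord_term]

lemma nodeVal_init (k : ℕ) (f : T.L2) (e : E) :
    T.nodeVal k f e (T.init e) = trace (weakDeriv k (f e)) 0 := by
  rw [nodeVal, coord_init]

lemma trace_continuous {ℓ : ℝ} (hℓ : 0 < ℓ) {Y : Type*} [TopologicalSpace Y] {c : Y → ℂ}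
    {g : Y → L2I ℓ} (hc : Continuous c) (hg : Continuous g) {x : ℝ} (hx : x = 0 ∨ x = ℓ) :
    Continuous fun y => trace (fromDeriv (c y) (g y)) x := by
  rcases hx with rfl | rfl
  · simpa only [trace_fromDeriv_zero hℓ] using hc
  · simp only [trace_fromDeriv_length hℓ]
    exact hc.add (continuous_const.inner hg)

lemma coord_eq (a : V) (e : E) : T.coord a e = 0 ∨ T.coord a e = T.length e := by
  rw [coord]; split_ifs <;> simp

lemma continuous_lift (e : E) : Continuous fun x : T.Param => T.lift x e := by
  cases he : T.kind e
  · simp only [lift_string he]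
    fun_prop
  · simp only [lift_beam he]
    fun_prop

lemma continuous_nodeVal_zero_lift (e : E) (a : V) :
    Continuous fun x : T.Param => T.nodeVal 0 (T.lift x) e a := by
  simp only [nodeVal, weakDeriv_zero]
  cases he : T.kind e
  · simp only [lift_string he]
    exact trace_continuous (T.length_pos e) (by fun_prop) (by fun_prop) (T.coord_eq a e)
  · simp only [lift_beam he]
    exact trace_continuous (T.length_pos e) (by fun_prop) (by fun_prop) (T.coord_eq a e)

lemma continuous_nodeVal_one_lift {e : E} (he : T.kind e = .beam) (a : V) :
    Continuous fun x : T.Param => T.nodeVal 1 (T.lift x) e a := by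
  simp only [nodeVal, lift_beam he, (isWeakDeriv_fromDeriv (T.length_pos e) _ _).eq]
  exact trace_continuous (T.length_pos e) (by fun_prop) (by fun_prop) (T.coord_eq a e)

variable [Fintype E]

variable (T) in
/-- The parameters of admissible displacements. -/
def admissible : Submodule ℂ T.Param where
  carrier := {x | T.InV (T.lift x) ∧ ∀ e, T.kind e = .string → x.2.2 e = 0}
  zero_mem' := by
    refine ⟨?_, fun e _ => rfl⟩
    have h := lift_smul (T := T) 0 0
    rw [zero_smul, zero_smul] at h
    rw [h]
    exact T.VSpace.zero_mem
  add_mem' := fun {x y} hx hy => by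
    refine ⟨?_, fun e he => ?_⟩
    · rw [lift_add]
      exact T.VSpace.add_mem hx.1 hy.1
    · simp [hx.2 e he, hy.2 e he]
  smul_mem' := fun c x hx => by
    refine ⟨?_, fun e he => ?_⟩
    · rw [lift_smul]
      exact T.VSpace.smul_mem c hx.1
    · simp [hx.2 e he]

lemma isClosed_admissible : IsClosed (T.admissible : Set T.Param) := by
  have h : (T.admissible : Set T.Param) =
      ({x | ∀ e ∈ T.incident T.root, T.nodeVal 0 (T.lift x) e T.root = 0} ∩
      {x | ∀ a, T.IsInterior a → ∀ e ∈ T.incident a, ∀ e' ∈ T.incident a,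
        T.nodeVal 0 (T.lift x) e a = T.nodeVal 0 (T.lift x) e' a}) ∩
      ({x | ∀ a, T.IsExterior a → a ≠ T.root → ∀ e ∈ T.incident a, T.kind e = .beam →
        T.nodeVal 1 (T.lift x) e a = 0} ∩
      {x | ∀ a, T.IsInterior a →
        ∑ e ∈ T.edgesAt .beam a, T.d a e * T.nodeVal 1 (T.lift x) e a = 0}) ∩
      {x | ∀ e, T.kind e = .string → x.2.2 e = 0} := by
    ext x
    constructor
    · rintro ⟨h, h'⟩
      exact ⟨⟨⟨h.root, h.continuous⟩, h.clamped, h.balance⟩, h'⟩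
    · rintro ⟨⟨⟨h1, h2⟩, h3, h4⟩, h5⟩
      exact ⟨⟨T.lift_mem_Sobolev x, h1, h2, h3, h4⟩, h5⟩
  rw [h]
  simp only [ofPred_forall]
  refine ((IsClosed.inter ?_ ?_).inter (IsClosed.inter ?_ ?_)).inter ?_
  · exact isClosed_iInter fun e => isClosed_iInter fun _ =>
      isClosed_eq (continuous_nodeVal_zero_lift e _) continuous_const
  · exact isClosed_iInter fun a => isClosed_iInter fun _ => isClosed_iInter fun e =>
      isClosed_iInter fun _ => isClosed_iInter fun e' => isClosed_iInter fun _ =>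
      isClosed_eq (continuous_nodeVal_zero_lift e _) (continuous_nodeVal_zero_lift e' _)
  · exact isClosed_iInter fun a => isClosed_iInter fun _ => isClosed_iInter fun _ =>
      isClosed_iInter fun e => isClosed_iInter fun _ => isClosed_iInter fun he =>
      isClosed_eq (continuous_nodeVal_one_lift he _) continuous_const
  · refine isClosed_iInter fun a => isClosed_iInter fun _ => isClosed_eq ?_ continuous_const
    exact continuous_finsetSum _ fun e he => continuous_const.mul
      (continuous_nodeVal_one_lift (T.mem_edgesAt.1 he).2 a)
  · exact isClosed_iInter fun e => isClosed_iInter fun _ =>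
      isClosed_eq (by fun_prop) continuous_const

lemma admissible_eq_zero {x : T.Param} (hx : x ∈ T.admissible) (h : x.1 = 0) : x = 0 := by
  have h0 : T.lift x = 0 := eq_zero_of_zero hx.1 fun e => by
    rw [(isWeakDeriv_lift x e).eq, h]; rfl
  have h1 : ∀ e, x.2.1 e = 0 := by
    intro e
    have h2 := nodeVal_init 0 (T.lift x) e
    rw [h0, nodeVal_zero, ← h0, weakDeriv_zero] at h2
    cases he : T.kind e
    · rw [lift_string he, trace_fromDeriv_zero (T.length_pos e)] at h2
      exact h2.symm
    · rw [lift_beam he, trace_fromDeriv_zero (T.length_pos e)] at h2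
      exact h2.symm
  have h2 : ∀ e, x.2.2 e = 0 := by
    intro e
    cases he : T.kind e
    · exact hx.2 e he
    · have h2 := nodeVal_init 1 (T.lift x) e
      rw [h0, nodeVal_zero, ← h0, lift_beam he, (isWeakDeriv_fromDeriv (T.length_pos e) _ _).eq,
        trace_fromDeriv_zero (T.length_pos e)] at h2
      exact h2.symm
  exact Prod.ext h (Prod.ext (funext h1) (funext h2))

/-- The Poincaré inequality. The projection of the parameters to the derivatives of highest order
has a finite dimensional kernel, hence it maps the closed subspace of admissible parameters onto a
closed subspace; being injective there, it is bounded below by the open mapping theorem. -/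
lemma exists_norm_le : ∃ C : ℝ≥0, ∀ x ∈ T.admissible, ‖x‖ ≤ C * ‖x.1‖ := by
  let f : T.admissible →L[ℂ] T.L2 :=
    (ContinuousLinearMap.fst ℂ T.L2 ((E → ℂ) × (E → ℂ))).comp T.admissible.subtypeL
  have hcomplete : CompleteSpace T.admissible :=
    (T.isClosed_admissible).completeSpace_coe
  have hinj : Function.Injective f := by
    rw [injective_iff_map_eq_zero]
    exact fun x hx => Subtype.ext (admissible_eq_zero x.2 hx)
  have hrange : IsClosed (range f) := by
    have h1 := Submodule.isClosed_sup_finiteDimensional T.admissible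
      (LinearMap.range (LinearMap.inr ℂ T.L2 ((E → ℂ) × (E → ℂ)))) T.isClosed_admissible
    have h2 : range f = (fun g : T.L2 => ((g, 0) : T.Param)) ⁻¹' (T.admissible ⊔
        LinearMap.range (LinearMap.inr ℂ T.L2 ((E → ℂ) × (E → ℂ))) : Submodule ℂ T.Param) := by
      ext g
      rw [mem_preimage, SetLike.mem_coe, Submodule.mem_sup]
      constructor
      · rintro ⟨x, rfl⟩
        refine ⟨x, x.2, _, ⟨-(x : T.Param).2, rfl⟩, ?_⟩
        ext1
        · exact add_zero _
        · exact add_neg_cancel _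
      · rintro ⟨x, hx, _, ⟨p, rfl⟩, h⟩
        refine ⟨⟨x, hx⟩, ?_⟩
        have h3 : x.1 = g := by simpa using congrArg Prod.fst h
        exact h3
    rw [h2]
    exact h1.preimage (by fun_prop)
  obtain ⟨C, hC⟩ := f.antilipschitz_of_injective_of_isClosed_range hinj hrange
  refine ⟨C, fun x hx => ?_⟩
  have := hC.le_mul_dist ⟨x, hx⟩ 0
  rwa [dist_zero_right, map_zero, dist_zero_right] at this

lemma eq_of_lift_eq {x y : T.Param} (hx : x ∈ T.admissible) (hy : y ∈ T.admissible)
    (h : T.lift x = T.lift y) : x = y := by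
  refine sub_eq_zero.1 (admissible_eq_zero (T.admissible.sub_mem hx hy) ?_)
  funext e
  have h1 := isWeakDeriv_lift x e
  rw [h] at h1
  rw [Prod.fst_sub, Pi.sub_apply, h1.unique (isWeakDeriv_lift y e), sub_self]
  rfl

variable (T) in
/-- The parameters of a function on the network. -/
def params (f : T.L2) : T.Param :=
  (fun e => weakDeriv (T.kind e).order (f e), fun e => trace (f e) 0, fun e =>
    match T.kind e with
    | .string => 0
    | .beam => trace (weakDeriv 1 (f e)) 0)

lemma lift_params {f : T.L2} (hf : T.InV f) : T.lift (T.params f) = f := by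
  funext e
  have hr := hf.regular e
  have hℓ := T.length_pos e
  cases he : T.kind e
  · rw [lift_string he]
    rw [he] at hr
    have h1 := Sobolev.spec hr le_rfl
    conv_rhs => rw [IsWeakDeriv.eq_fromDeriv hℓ h1]
    simp only [params, he]
  · rw [lift_beam he]
    rw [he] at hr
    have h1 := Sobolev.spec hr (by simp [Material.order] : 1 ≤ _)
    have h2 := h1.of_add (j := 1) (Sobolev.spec hr (by simp [Material.order] : 1 + 1 ≤ _))
    conv_rhs => rw [IsWeakDeriv.eq_fromDeriv hℓ h1, IsWeakDeriv.eq_fromDeriv hℓ h2]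
    simp only [params, he, Material.order]

lemma params_mem {f : T.L2} (hf : T.InV f) : T.params f ∈ T.admissible :=
  ⟨by rwa [lift_params hf], fun e he => by simp only [params, he]⟩

lemma norm_sq_eq (y : T.EnergySpace) :
    ‖y‖ ^ 2 = ∑ e, ‖weakDeriv (T.kind e).order (y.disp e)‖ ^ 2 + ∑ e, ‖y.vel e‖ ^ 2 := by
  have h1 : ‖y‖ ^ 2 = (inner ℂ y y).re := (inner_self_eq_norm_sq (𝕜 := ℂ) y).symm
  rw [h1, inner_eq]
  simp [energyInner, inner_self_eq_norm_sq_to_K, ← Complex.ofReal_pow]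

lemma norm_weakDeriv_disp_le (y : T.EnergySpace) (e : E) :
    ‖weakDeriv (T.kind e).order (y.disp e)‖ ≤ ‖y‖ := by
  refine (pow_le_pow_iff_left₀ (norm_nonneg _) (norm_nonneg _) two_ne_zero).1 ?_
  rw [norm_sq_eq]
  refine (Finset.single_le_sum (f := fun e => ‖weakDeriv (T.kind e).order (y.disp e)‖ ^ 2)
    (fun _ _ => by positivity) (Finset.mem_univ e)).trans (le_add_of_nonneg_right (by positivity))

lemma norm_vel_le (y : T.EnergySpace) (e : E) : ‖y.vel e‖ ≤ ‖y‖ := by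
  refine (pow_le_pow_iff_left₀ (norm_nonneg _) (norm_nonneg _) two_ne_zero).1 ?_
  rw [norm_sq_eq]
  exact (Finset.single_le_sum (f := fun e => ‖y.vel e‖ ^ 2)
    (fun _ _ => by positivity) (Finset.mem_univ e)).trans (le_add_of_nonneg_left (by positivity))

variable (T) in
/-- The velocity as a bounded operator on the energy space. -/
def velL : T.EnergySpace →L[ℂ] T.L2 :=
  LinearMap.mkContinuous
    { toFun := EnergySpace.vel
      map_add' := fun _ _ => rfl
      map_smul' := fun _ _ => rfl }
    1 fun y => by
      rw [one_mul]
      exact (pi_norm_le_iff_of_nonneg (norm_nonneg y)).2 (norm_vel_le y)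

variable (T) in
/-- The parameters of the displacement as a bounded operator on the energy space. -/
def paramsL : T.EnergySpace →L[ℂ] T.Param :=
  LinearMap.mkContinuous
    { toFun := fun y => T.params y.disp
      map_add' := fun y z => by
        refine eq_of_lift_eq (params_mem (y + z).disp_mem)
          (T.admissible.add_mem (params_mem y.disp_mem) (params_mem z.disp_mem)) ?_
        rw [lift_add, lift_params (y + z).disp_mem, lift_params y.disp_mem, lift_params z.disp_mem]
        rfl
      map_smul' := fun c y => by
        refine eq_of_lift_eq (params_mem (c • y).disp_mem)
          (T.admissible.smul_mem c (params_mem y.disp_mem)) ?_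
        rw [lift_smul, lift_params (c • y).disp_mem, lift_params y.disp_mem]
        rfl }
    (T.exists_norm_le.choose : ℝ) fun y => by
      refine (T.exists_norm_le.choose_spec _ (params_mem y.disp_mem)).trans ?_
      refine mul_le_mul_of_nonneg_left ?_ (NNReal.coe_nonneg _)
      exact (pi_norm_le_iff_of_nonneg (norm_nonneg y)).2 (norm_weakDeriv_disp_le y)

lemma paramsL_mem (y : T.EnergySpace) : T.paramsL y ∈ T.admissible := params_mem y.disp_mem

lemma lift_paramsL (y : T.EnergySpace) : T.lift (T.paramsL y) = y.disp := lift_params y.disp_mem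

lemma norm_sq_eq_params (y : T.EnergySpace) :
    ‖y‖ ^ 2 = ∑ e, ‖(T.paramsL y).1 e‖ ^ 2 + ∑ e, ‖T.velL y e‖ ^ 2 := norm_sq_eq y

instance : CompleteSpace T.EnergySpace := by
  refine Metric.complete_of_cauchySeq_tendsto fun y hy => ?_
  obtain ⟨x, hx⟩ := cauchySeq_tendsto_of_complete (T.paramsL.uniformContinuous.comp_cauchySeq hy)
  obtain ⟨v, hv⟩ := cauchySeq_tendsto_of_complete (T.velL.uniformContinuous.comp_cauchySeq hy)
  have hxm : x ∈ T.admissible :=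
    T.isClosed_admissible.mem_of_tendsto hx (Eventually.of_forall fun n => paramsL_mem (y n))
  let z : T.EnergySpace := EnergySpace.mk (T.lift x) v hxm.1
  have hz : T.paramsL z = x := eq_of_lift_eq (paramsL_mem z) hxm (lift_paramsL z)
  have hz' : T.velL z = v := rfl
  refine ⟨z, tendsto_iff_norm_sub_tendsto_zero.2 ?_⟩
  have h1 : Tendsto (fun n => ‖y n - z‖ ^ 2) atTop (𝓝 0) := by
    simp only [norm_sq_eq_params, map_sub, hz, hz']
    have h2 : Tendsto (fun n => (T.paramsL (y n), T.velL (y n))) atTop (𝓝 (x, v)) :=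
      hx.prodMk_nhds hv
    have h3 : Continuous fun p : T.Param × T.L2 =>
        ∑ e, ‖(p.1 - x).1 e‖ ^ 2 + ∑ e, ‖(p.2 - v) e‖ ^ 2 := by
      simp only [Prod.fst_sub, Pi.sub_apply]
      fun_prop
    have h4 := (h3.tendsto (x, v)).comp h2
    simpa [Function.comp_def] using h4
  have h5 := h1.sqrt
  simpa [Real.sqrt_sq] using h5

variable (T) in
/-- The displacement on the edge `e` as a bounded operator on the energy space. -/
def dispL (e : E) : T.EnergySpace →L[ℂ] L2I (T.length e) where
  toFun y := y.disp e
  map_add' _ _ := rfl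
  map_smul' _ _ := rfl
  cont := by
    simp only [← lift_paramsL]
    exact (continuous_lift e).comp T.paramsL.continuous

variable (T) in
/-- The value of the displacement at the end `a` of the edge `e` as a bounded functional on the
energy space. -/
def nodeValL (e : E) (a : V) : T.EnergySpace →L[ℂ] ℂ where
  toFun y := T.nodeVal 0 y.disp e a
  map_add' y z := nodeVal_add (y.disp_mem.regular e) (z.disp_mem.regular e) (T.kind e).order_pos a
  map_smul' c y := nodeVal_smul (y.disp_mem.regular e) c (T.kind e).order_pos a
  cont := by
    simp only [← lift_paramsL]
    exact (continuous_nodeVal_zero_lift e a).comp T.paramsL.continuous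

end Poincare

section Operator

variable {V E : Type*} {T : Network V E}

/-! ### Green's formula on the network -/

lemma d_term (e : E) : T.d (T.term e) e = 1 := by simp [d]

lemma d_init (e : E) : T.d (T.init e) e = -1 := by simp [d, (T.init_ne_term e).symm]

lemma d_of_not_incident {a : V} {e : E} (h : e ∉ T.incident a) : T.d a e = 0 := by
  simp only [incident, mem_ofPred_eq, not_or] at h
  simp [d, h.1, h.2]

lemma conj_d (a : V) (e : E) : conj (T.d a e) = T.d a e := by
  rw [d]; split_ifs <;> simp

lemma d_mul_d {a : V} {e : E} (h : e ∈ T.incident a) : T.d a e * T.d a e = 1 := by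
  rcases h with rfl | rfl
  · rw [d_init]; ring
  · rw [d_term]; ring

variable (T) in
/-- The force that the edge `e` exerts at its end `a`, up to orientation: `∂u` on strings and `-∂³u`
on beams. -/
def flux (u : T.L2) (e : E) (a : V) : ℂ :=
  match T.kind e with
  | .string => T.nodeVal 1 u e a
  | .beam => -T.nodeVal 3 u e a

variable (T) in
/-- The bending moment of the edge `e` at its end `a`: `∂²u` on beams, and `0` on strings. -/
def moment (u : T.L2) (e : E) (a : V) : ℂ :=
  match T.kind e with
  | .string => 0
  | .beam => T.nodeVal 2 u e a

lemma flux_string {e : E} (he : T.kind e = .string) (u : T.L2) (a : V) :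
    T.flux u e a = T.nodeVal 1 u e a := by rw [flux, he]

lemma flux_beam {e : E} (he : T.kind e = .beam) (u : T.L2) (a : V) :
    T.flux u e a = -T.nodeVal 3 u e a := by rw [flux, he]

lemma moment_string {e : E} (he : T.kind e = .string) (u : T.L2) (a : V) :
    T.moment u e a = 0 := by rw [moment, he]

lemma moment_beam {e : E} (he : T.kind e = .beam) (u : T.L2) (a : V) :
    T.moment u e a = T.nodeVal 2 u e a := by rw [moment, he]

variable (T) in
/-- The boundary term at the end `a` of the edge `e` in Green's formula. -/
def boundaryTerm (u w : T.L2) (e : E) (a : V) : ℂ :=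
  conj (T.flux u e a) * T.nodeVal 0 w e a + conj (T.moment u e a) * T.nodeVal 1 w e a

/-- A vertex is the root, another exterior vertex, or interior. -/
lemma vertex_cases {a : V} {e : E} (he : e ∈ T.incident a) :
    a = T.root ∨ (T.IsExterior a ∧ a ≠ T.root) ∨ (T.IsInterior a ∧ a ≠ T.root) := by
  by_cases ha : a = T.root
  · exact Or.inl ha
  by_cases hi : T.IsInterior a
  · exact Or.inr (Or.inr ⟨hi, ha⟩)
  · refine Or.inr (Or.inl ⟨⟨e, he, fun e' he' => ?_⟩, ha⟩)
    by_contra hne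
    exact hi ⟨e', he', e, he, hne⟩

lemma IsInterior.not_isExterior {a : V} (h : T.IsInterior a) : ¬ T.IsExterior a := by
  rintro ⟨e, _, he⟩
  obtain ⟨x, hx, y, hy, hxy⟩ := h
  exact hxy ((he x hx).trans (he y hy).symm)

lemma elastic_string {e : E} (he : T.kind e = .string) (u : T.L2) :
    T.elastic u e = weakDeriv 2 (u e) := by rw [elastic, he]

lemma elastic_beam {e : E} (he : T.kind e = .beam) (u : T.L2) :
    T.elastic u e = -weakDeriv 4 (u e) := by rw [elastic, he]

lemma root_not_isInterior {a : V} (h : T.IsInterior a) : a ≠ T.root := by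
  rintro rfl
  exact h.not_isExterior T.root_exterior

/-- Green's formula on an edge. -/
lemma inner_add_inner_elastic {u w : T.L2} {e : E}
    (hu : u e ∈ Sobolev (T.length e) (2 * (T.kind e).order))
    (hw : w e ∈ Sobolev (T.length e) (T.kind e).order) :
    inner ℂ (weakDeriv (T.kind e).order (u e)) (weakDeriv (T.kind e).order (w e)) +
      inner ℂ (T.elastic u e) (w e) =
    T.boundaryTerm u w e (T.term e) - T.boundaryTerm u w e (T.init e) := by
  have hℓ := T.length_pos e
  simp only [boundaryTerm]
  cases he : T.kind e
  · rw [he] at hu hw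
    have u1 := Sobolev.spec hu (by simp [Material.order] : 1 ≤ _)
    have u2 := u1.of_add (j := 1) (Sobolev.spec hu (by simp [Material.order] : 1 + 1 ≤ _))
    have w1 := Sobolev.spec hw (by simp [Material.order] : 1 ≤ _)
    simp only [flux_string he, moment_string he, elastic_string he, nodeVal_term, nodeVal_init,
      weakDeriv_zero, map_zero, zero_mul, add_zero]
    rw [← u2.inner_add_inner hℓ w1]
    simp only [Material.order]
    ring
  · rw [he] at hu hw
    have u2 := Sobolev.spec hu (by simp [Material.order] : 2 ≤ _)
    have u3 := Sobolev.spec hu (by simp [Material.order] : 2 + 1 ≤ _)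
    have u4 := Sobolev.spec hu (by simp [Material.order] : 3 + 1 ≤ _)
    have w1 := Sobolev.spec hw (by simp [Material.order] : 1 ≤ _)
    have w2 := Sobolev.spec hw (by simp [Material.order] : 1 + 1 ≤ _)
    have h1 := (u3.of_add u4).inner_add_inner hℓ w1
    have h2 := (u2.of_add u3).inner_add_inner hℓ (w1.of_add w2)
    simp only [flux_beam he, moment_beam he, elastic_beam he, nodeVal_term, nodeVal_init,
      weakDeriv_zero, map_neg, inner_neg_left, Material.order]
    linear_combination h2 - h1

variable [Fintype E]

variable (T) in
open Classical in
/-- The finite set of vertices. -/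
def verts : Finset V := Finset.univ.image T.init ∪ Finset.univ.image T.term

lemma mem_verts {a : V} {e : E} (h : e ∈ T.incident a) : a ∈ T.verts := by
  rcases h with rfl | rfl <;> simp [verts]

lemma sum_ends (B : E → V → ℂ) : ∑ e, (B e (T.term e) - B e (T.init e)) =
    ∑ a ∈ T.verts, ∑ e, T.d a e * B e a := by
  rw [Finset.sum_comm]
  refine Finset.sum_congr rfl fun e _ => ?_
  have hne := T.init_ne_term e
  rw [Finset.sum_eq_add (T.term e) (T.init e) hne.symm]
  · rw [d_term, d_init]; ring
  · intro a _ ha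
    rw [d_of_not_incident, zero_mul]
    rintro (h | h)
    · exact ha.2 h.symm
    · exact ha.1 h.symm
  · intro h; exact absurd (mem_verts (Or.inr rfl)) h
  · intro h; exact absurd (mem_verts (Or.inl rfl)) h

lemma sum_d_mul (a : V) (f : E → ℂ) : ∑ e, T.d a e * f e =
    ∑ e ∈ T.edgesAt .string a, T.d a e * f e + ∑ e ∈ T.edgesAt .beam a, T.d a e * f e := by
  classical
  rw [← Finset.sum_union]
  · refine (Finset.sum_subset (Finset.subset_univ _) fun e _ he => ?_).symm
    rw [d_of_not_incident, zero_mul]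
    intro h
    rw [Finset.mem_union, mem_edgesAt, mem_edgesAt] at he
    cases hk : T.kind e <;> simp [h, hk] at he
  · rw [Finset.disjoint_left]
    intro e h h'
    rw [mem_edgesAt] at h h'
    exact Material.noConfusion (h.2.symm.trans h'.2)

lemma sum_d_mul_of_unique {a : V} {e : E} (h : ∀ e' ∈ T.incident a, e' = e) (f : E → ℂ) :
    ∑ e', T.d a e' * f e' = T.d a e * f e := by
  refine Finset.sum_eq_single e (fun e' _ hne => ?_) (fun h => absurd (Finset.mem_univ e) h)
  rw [d_of_not_incident fun h' => hne (h e' h'), zero_mul]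

variable (T) in
open Classical in
/-- The pairs of an exterior vertex other than the root and its edge, where the feedback acts. -/
def feedback : Finset (E × V) :=
  {p ∈ Finset.univ ×ˢ T.verts | p.1 ∈ T.incident p.2 ∧ T.IsExterior p.2 ∧ p.2 ≠ T.root}

open Classical in
lemma sum_feedback (f : E → V → ℂ) : ∑ p ∈ T.feedback, f p.1 p.2 =
    ∑ a ∈ T.verts, ∑ e, if e ∈ T.incident a ∧ T.IsExterior a ∧ a ≠ T.root then f e a else 0 := by
  rw [feedback, Finset.sum_filter, Finset.sum_product_right]

lemma InV.nodeVal_eq {w : T.L2} (hw : T.InV w) {a : V} {e e' : E} (he : e ∈ T.incident a)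
    (he' : e' ∈ T.incident a) : T.nodeVal 0 w e a = T.nodeVal 0 w e' a := by
  by_cases h : e = e'
  · rw [h]
  · exact hw.continuous a ⟨e, he, e', he', h⟩ e he e' he'

/-- The weak form of the equilibrium and feedback conditions: the boundary terms of Green's formula
cancel at the root and at the interior vertices, and equal the feedback at the other vertices. -/
lemma InDomain.sum_eq {u v w : T.L2} (h : T.InDomain u v) (hw : T.InV w) :
    ∑ e, (inner ℂ (weakDeriv (T.kind e).order (u e)) (weakDeriv (T.kind e).order (w e)) +
      inner ℂ (T.elastic u e) (w e)) =
    -∑ p ∈ T.feedback, conj (T.nodeVal 0 v p.1 p.2) * T.nodeVal 0 w p.1 p.2 := by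
  classical
  rw [Finset.sum_congr rfl fun e _ => inner_add_inner_elastic (h.regular e) (hw.regular e),
    sum_ends, sum_feedback (fun e a => conj (T.nodeVal 0 v e a) * T.nodeVal 0 w e a),
    ← Finset.sum_neg_distrib]
  refine Finset.sum_congr rfl fun a ha => ?_
  obtain ⟨e₀, he₀⟩ : ∃ e, e ∈ T.incident a := by
    simp only [verts, Finset.mem_union, Finset.mem_image, Finset.mem_univ, true_and] at ha
    rcases ha with ⟨e, he⟩ | ⟨e, he⟩
    · exact ⟨e, Or.inl he⟩
    · exact ⟨e, Or.inr he⟩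
  rcases vertex_cases he₀ with rfl | ⟨hext, hroot⟩ | ⟨hint, hroot⟩
  · have huniq : ∀ e' ∈ T.incident T.root, e' = e₀ := fun e' he' => T.root_exterior.unique he' he₀
    rw [sum_d_mul_of_unique huniq, boundaryTerm, hw.root e₀ he₀]
    have hm : T.moment u e₀ T.root = 0 := by
      cases hk : T.kind e₀
      · exact moment_string hk _ _
      · rw [moment_beam hk, h.root_moment e₀ he₀ hk]
    simp [hm]
  · have huniq : ∀ e' ∈ T.incident a, e' = e₀ := fun e' he' => hext.unique he' he₀
    rw [sum_d_mul_of_unique huniq, Finset.sum_eq_single e₀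
      (fun e' _ hne => if_neg fun hc => hne (huniq e' hc.1))
      (fun h => absurd (Finset.mem_univ e₀) h), if_pos ⟨he₀, hext, hroot⟩, boundaryTerm]
    have hdd := d_mul_d he₀
    cases hk : T.kind e₀
    · rw [flux_string hk, moment_string hk, h.string_feedback a hext hroot e₀ he₀ hk, map_neg,
        map_mul, conj_d, map_zero]
      linear_combination -(conj (T.nodeVal 0 v e₀ a) * T.nodeVal 0 w e₀ a) * hdd
    · rw [flux_beam hk, hw.clamped a hext hroot e₀ he₀ hk, h.beam_feedback a hext hroot e₀ he₀ hk,
        map_neg, map_mul, conj_d]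
      linear_combination -(conj (T.nodeVal 0 v e₀ a) * T.nodeVal 0 w e₀ a) * hdd
  · have hne : ∀ e, ¬ (e ∈ T.incident a ∧ T.IsExterior a ∧ a ≠ T.root) := fun e hc =>
      hint.not_isExterior hc.2.1
    simp only [if_neg (hne _), Finset.sum_const_zero, neg_zero, boundaryTerm, mul_add,
      Finset.sum_add_distrib]
    have h1 : ∑ e, T.d a e * (conj (T.flux u e a) * T.nodeVal 0 w e a) =
        conj (∑ e, T.d a e * T.flux u e a) * T.nodeVal 0 w e₀ a := by
      rw [map_sum, Finset.sum_mul]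
      refine Finset.sum_congr rfl fun e _ => ?_
      by_cases he : e ∈ T.incident a
      · rw [hw.nodeVal_eq he he₀, map_mul, conj_d, mul_assoc]
      · rw [d_of_not_incident he]; simp
    have h2 : ∑ e, T.d a e * T.flux u e a = 0 := by
      rw [sum_d_mul, ← h.force_balance a hint, sub_eq_add_neg, ← Finset.sum_neg_distrib]
      congr 1
      · exact Finset.sum_congr rfl fun e he => by rw [flux_string (T.mem_edgesAt.1 he).2]
      · exact Finset.sum_congr rfl fun e he => by rw [flux_beam (T.mem_edgesAt.1 he).2, mul_neg]
    -- the moments of the beams agree, and the slopes of `w` are balanced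
    have h3 : ∑ e, T.d a e * (conj (T.moment u e a) * T.nodeVal 1 w e a) = 0 := by
      rw [sum_d_mul, Finset.sum_eq_zero fun e he => ?_, zero_add]
      · rcases (T.edgesAt .beam a).eq_empty_or_nonempty with h0 | ⟨e₁, he₁⟩
        · rw [h0, Finset.sum_empty]
        · rw [← mul_zero (conj (T.nodeVal 2 u e₁ a)), ← hw.balance a hint, Finset.mul_sum]
          refine Finset.sum_congr rfl fun e he => ?_
          rw [moment_beam (T.mem_edgesAt.1 he).2, h.moment_continuous a hint e he e₁ he₁]
          ring
      · rw [moment_string (T.mem_edgesAt.1 he).2]; simp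
    rw [h1, h2, h3]
    simp

/-! ### Regularity of weak solutions -/

/-- A criterion for admissibility in terms of the vertex values and the slopes of the beams. -/
lemma inV_of_nodeVal {w : T.L2} {p : V → ℂ} {s : E → V → ℂ}
    (hreg : ∀ e, w e ∈ Sobolev (T.length e) (T.kind e).order)
    (hp : ∀ a, ∀ e ∈ T.incident a, T.nodeVal 0 w e a = p a)
    (hs : ∀ a, ∀ e ∈ T.incident a, T.kind e = .beam → T.nodeVal 1 w e a = s e a)
    (hroot : p T.root = 0)
    (hclamped : ∀ a, T.IsExterior a → a ≠ T.root → ∀ e ∈ T.incident a, T.kind e = .beam → s e a = 0)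
    (hbalance : ∀ a, T.IsInterior a → ∑ e ∈ T.edgesAt .beam a, T.d a e * s e a = 0) :
    T.InV w where
  regular := hreg
  root e he := by rw [hp _ e he, hroot]
  continuous a _ e he e' he' := by rw [hp a e he, hp a e' he']
  clamped a ha har e he hk := by rw [hs a e he hk, hclamped a ha har e he hk]
  balance a ha := by
    rw [← hbalance a ha]
    refine Finset.sum_congr rfl fun e he => ?_
    rw [hs a e (T.mem_edgesAt.1 he).1 (T.mem_edgesAt.1 he).2]

/-- Affine functions on strings and cubic polynomials on beams provide admissible displacements with
prescribed vertex values and slopes of the beams. -/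
lemma exists_inV {p : V → ℂ} {s : E → V → ℂ} (hroot : p T.root = 0)
    (hclamped : ∀ a, T.IsExterior a → a ≠ T.root → ∀ e ∈ T.incident a, T.kind e = .beam → s e a = 0)
    (hbalance : ∀ a, T.IsInterior a → ∑ e ∈ T.edgesAt .beam a, T.d a e * s e a = 0) :
    ∃ w, T.InV w ∧ (∀ a, ∀ e ∈ T.incident a, T.nodeVal 0 w e a = p a) ∧
      ∀ a, ∀ e ∈ T.incident a, T.kind e = .beam → T.nodeVal 1 w e a = s e a := by
  have hex : ∀ e, ∃ g : L2I (T.length e),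
      (T.kind e = .string → trace (fromDeriv (p (T.init e)) g) (T.length e) = p (T.term e)) ∧
      (T.kind e = .beam → trace (fromDeriv (p (T.init e)) (fromDeriv (s e (T.init e)) g))
        (T.length e) = p (T.term e) ∧
        trace (fromDeriv (s e (T.init e)) g) (T.length e) = s e (T.term e)) := by
    intro e
    have hℓ := T.length_pos e
    cases hk : T.kind e
    · refine ⟨((p (T.term e) - p (T.init e)) / T.length e) • one _, fun _ => ?_, by simp⟩
      have hne : (T.length e : ℂ) ≠ 0 := Complex.ofReal_ne_zero.2 hℓ.ne'
      rw [trace_fromDeriv_length hℓ, inner_smul_right, inner_one_one hℓ]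
      field_simp
      ring
    · obtain ⟨g, hg⟩ := exists_hermite hℓ (p (T.init e)) (p (T.term e)) (s e (T.init e))
        (s e (T.term e))
      exact ⟨g, by simp, fun _ => hg⟩
  choose g hg1 hg2 using hex
  set x : T.Param := (g, fun e => p (T.init e), fun e => s e (T.init e)) with hx
  have h0 : ∀ a, ∀ e ∈ T.incident a, T.nodeVal 0 (T.lift x) e a = p a := by
    intro a e he
    have hℓ := T.length_pos e
    rcases he with rfl | rfl
    · rw [nodeVal_init, weakDeriv_zero]
      cases hk : T.kind e
      · rw [lift_string hk, trace_fromDeriv_zero hℓ]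
      · rw [lift_beam hk, trace_fromDeriv_zero hℓ]
    · rw [nodeVal_term, weakDeriv_zero]
      cases hk : T.kind e
      · rw [lift_string hk, hg1 e hk]
      · rw [lift_beam hk, (hg2 e hk).1]
  have h1 : ∀ a, ∀ e ∈ T.incident a, T.kind e = .beam → T.nodeVal 1 (T.lift x) e a = s e a := by
    intro a e he hk
    have hℓ := T.length_pos e
    rcases he with rfl | rfl
    · rw [nodeVal_init, lift_beam hk, (isWeakDeriv_fromDeriv hℓ _ _).eq, trace_fromDeriv_zero hℓ]
    · rw [nodeVal_term, lift_beam hk, (isWeakDeriv_fromDeriv hℓ _ _).eq, (hg2 e hk).2]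
  exact ⟨T.lift x, inV_of_nodeVal (lift_mem_Sobolev x) h0 h1 hroot hclamped hbalance, h0, h1⟩

open Classical in
/-- A function on a single edge that vanishes at both ends, on beams together with its first
derivative, is an admissible displacement. -/
lemma inV_lift_single {e₀ : E} {k : L2I (T.length e₀)} (h1 : inner ℂ (one (T.length e₀)) k = 0)
    (h2 : T.kind e₀ = .beam → inner ℂ (one (T.length e₀)) (primL (T.length e₀) k) = 0) :
    T.InV (T.lift (Pi.single e₀ k, 0, 0)) ∧
    (∀ e a, e ∈ T.incident a → T.nodeVal 0 (T.lift (Pi.single e₀ k, 0, 0)) e a = 0) ∧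
    ∀ e ≠ e₀, T.lift (Pi.single e₀ k, 0, 0) e = 0 := by
  have hzero : ∀ e ≠ e₀, T.lift (Pi.single e₀ k, 0, 0) e = 0 := by
    intro e he
    cases hk : T.kind e
    · rw [lift_string hk]; simp [he, fromDeriv]
    · rw [lift_beam hk]; simp [he, fromDeriv]
  have h0 : ∀ {e a}, e ∈ T.incident a → T.nodeVal 0 (T.lift (Pi.single e₀ k, 0, 0)) e a = 0 := by
    intro e a he
    have hℓ := T.length_pos e
    by_cases hee : e = e₀
    · subst hee
      rcases he with rfl | rfl
      · rw [nodeVal_init, weakDeriv_zero]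
        cases hk : T.kind e
        · rw [lift_string hk, trace_fromDeriv_zero hℓ]; rfl
        · rw [lift_beam hk, trace_fromDeriv_zero hℓ]; rfl
      · rw [nodeVal_term, weakDeriv_zero]
        cases hk : T.kind e
        · rw [lift_string hk, trace_fromDeriv_length hℓ]
          simp [h1]
        · rw [lift_beam hk, trace_fromDeriv_length hℓ]
          simp [fromDeriv, h2 hk]
    · rw [nodeVal, hzero e hee]
      exact Sobolev_zero (m := 1) hℓ (T.coord_mem a e) le_rfl
  refine ⟨inV_of_nodeVal (p := 0) (s := 0) (lift_mem_Sobolev _) (fun a e he => h0 he) ?_ rfl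
    (by simp) (by simp), fun e a he => h0 he, hzero⟩
  intro a e he hk
  have hℓ := T.length_pos e
  by_cases hee : e = e₀
  · subst hee
    rcases he with rfl | rfl
    · rw [nodeVal_init, lift_beam hk, (isWeakDeriv_fromDeriv hℓ _ _).eq, trace_fromDeriv_zero hℓ]
      rfl
    · rw [nodeVal_term, lift_beam hk, (isWeakDeriv_fromDeriv hℓ _ _).eq, trace_fromDeriv_length hℓ]
      simp [h1]
  · rw [nodeVal, hzero e hee]
    exact Sobolev_zero (m := 2) hℓ (T.coord_mem a e) le_rfl

/-- `u` and `v` satisfy the weak form of `elastic u = G` with feedback by the velocity `v`. -/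
def IsWeakSolution (u v G : T.L2) : Prop :=
  ∀ w, T.InV w →
    ∑ e, (inner ℂ (weakDeriv (T.kind e).order (u e)) (weakDeriv (T.kind e).order (w e)) +
      inner ℂ (G e) (w e)) =
    -∑ p ∈ T.feedback, conj (T.nodeVal 0 v p.1 p.2) * T.nodeVal 0 w p.1 p.2

lemma mem_incident_of_mem_feedback {p : E × V} (h : p ∈ T.feedback) : p.1 ∈ T.incident p.2 := by
  classical
  rw [feedback, Finset.mem_filter] at h
  exact h.2.1

open Classical in
lemma IsWeakSolution.inner_eq {u v G : T.L2} (h : IsWeakSolution u v G) {e : E}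
    {k : L2I (T.length e)} (h1 : inner ℂ (one (T.length e)) k = 0)
    (h2 : T.kind e = .beam → inner ℂ (one (T.length e)) (primL (T.length e) k) = 0) :
    inner ℂ (weakDeriv (T.kind e).order (u e)) k =
      -inner ℂ (G e) (T.lift (Pi.single e k, 0, 0) e) := by
  obtain ⟨hw, hn, hz⟩ := inV_lift_single h1 h2
  have h3 := h _ hw
  rw [Finset.sum_eq_zero (s := T.feedback) fun p hp => by
      rw [hn _ _ (mem_incident_of_mem_feedback hp), mul_zero], neg_zero, Finset.sum_eq_single e (fun e' _ he' => ?_) (fun h => absurd (Finset.mem_univ e) h),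
    (isWeakDeriv_lift _ e).eq] at h3
  · simp only [Pi.single_eq_same] at h3
    exact eq_neg_of_add_eq_zero_left h3
  · rw [(isWeakDeriv_lift _ e').eq, hz e' he']
    simp [Pi.single_eq_of_ne he']

/-- Interior regularity: a weak solution has all the derivatives that occur in the operator. -/
lemma IsWeakSolution.regular {u v G : T.L2} (hu : T.InV u) (h : IsWeakSolution u v G) (e : E) :
    u e ∈ Sobolev (T.length e) (2 * (T.kind e).order) ∧ T.elastic u e = G e := by
  classical
  have hℓ := T.length_pos e
  have hr := hu.regular e
  cases hk : T.kind e
  · obtain ⟨c, hc⟩ := exists_eq_fromDeriv (m := weakDeriv 1 (u e)) (g := G e) hℓ fun k hk1 => by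
      have h1 := h.inner_eq hk1 (by simp [hk])
      rw [lift_string hk] at h1
      simpa [hk, fromDeriv, Material.order] using h1
    rw [hk] at hr
    have h1 : IsWeakDeriv 1 (u e) (weakDeriv 1 (u e)) := Sobolev.spec hr le_rfl
    rw [hc] at h1
    have h2 := isWeakDeriv_fromDeriv hℓ c (G e)
    refine ⟨h1.mem_Sobolev_succ (h2.mem_Sobolev_succ (mem_Sobolev_zero _)), ?_⟩
    rw [elastic_string hk]
    exact (h1.comp h2).eq
  · obtain ⟨c, s, hc⟩ := exists_eq_fromDeriv_fromDeriv (m := weakDeriv 2 (u e)) (g := G e) hℓ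
      fun k hk1 hk2 => by
        have h1 := h.inner_eq hk1 fun _ => hk2
        rw [lift_beam hk] at h1
        simpa [hk, fromDeriv, Material.order] using h1
    rw [hk] at hr
    have h1 := Sobolev.spec hr (by simp [Material.order] : 1 ≤ _)
    have h2 := h1.of_add (j := 1) (Sobolev.spec hr (by simp [Material.order] : 1 + 1 ≤ _))
    rw [show 1 + 1 = 2 from rfl, hc] at h2
    have h3 := isWeakDeriv_fromDeriv hℓ c (fromDeriv s (-G e))
    have h4 := isWeakDeriv_fromDeriv hℓ s (-G e)
    refine ⟨h1.mem_Sobolev_succ (h2.mem_Sobolev_succ (h3.mem_Sobolev_succ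
      (h4.mem_Sobolev_succ (mem_Sobolev_zero _)))), ?_⟩
    rw [elastic_beam hk, neg_eq_iff_eq_neg]
    exact (((h1.comp h2).comp h3).comp h4).eq

/-- The boundary form of a weak solution, for test functions with vertex values `p` and slopes `s`. -/
lemma IsWeakSolution.sum_boundary {u v G : T.L2} (hu : T.InV u) (h : IsWeakSolution u v G)
    {p : V → ℂ} {s : E → V → ℂ} (hroot : p T.root = 0)
    (hclamped : ∀ a, T.IsExterior a → a ≠ T.root → ∀ e ∈ T.incident a, T.kind e = .beam → s e a = 0)
    (hbalance : ∀ a, T.IsInterior a → ∑ e ∈ T.edgesAt .beam a, T.d a e * s e a = 0) :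
    ∑ a ∈ T.verts, ∑ e, T.d a e *
      (conj (T.flux u e a) * p a + conj (T.moment u e a) * s e a) =
    -∑ q ∈ T.feedback, conj (T.nodeVal 0 v q.1 q.2) * p q.2 := by
  obtain ⟨w, hw, h0, h1⟩ := exists_inV hroot hclamped hbalance
  have h2 := h w hw
  rw [Finset.sum_congr rfl fun e _ => by
    rw [← (h.regular hu e).2, inner_add_inner_elastic (h.regular hu e).1 (hw.regular e)],
    sum_ends] at h2
  rw [Finset.sum_congr (s₁ := T.feedback) rfl fun q hq => by
    rw [← h0 _ _ (mem_incident_of_mem_feedback hq)], ← h2]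
  refine Finset.sum_congr rfl fun a _ => Finset.sum_congr rfl fun e _ => ?_
  by_cases he : e ∈ T.incident a
  · rw [boundaryTerm, h0 a e he]
    cases hk : T.kind e
    · rw [moment_string hk]; simp
    · rw [h1 a e he hk]
  · rw [d_of_not_incident he, zero_mul, zero_mul]

open Classical in
/-- The balance of forces at a vertex, obtained from the test function that is `1` at this vertex, `0`
at all others, and has vanishing slopes. -/
lemma IsWeakSolution.sum_flux {u v G : T.L2} (hu : T.InV u) (h : IsWeakSolution u v G)
    {a : V} {e₀ : E} (he₀ : e₀ ∈ T.incident a) (ha : a ≠ T.root) :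
    ∑ e, T.d a e * conj (T.flux u e a) =
    -∑ e, if e ∈ T.incident a ∧ T.IsExterior a ∧ a ≠ T.root then
      conj (T.nodeVal 0 v e a) else 0 := by
  have h1 := h.sum_boundary hu (p := Pi.single a 1) (s := 0) (Pi.single_eq_of_ne ha.symm _)
    (by simp) (by simp)
  rw [sum_feedback (fun e b => conj (T.nodeVal 0 v e b) * (Pi.single a 1 : V → ℂ) b),
    Finset.sum_eq_single a (fun b _ hb => by simp [hb])
      (fun hn => absurd (mem_verts he₀) hn),
    Finset.sum_eq_single a (fun b _ hb => by simp [hb])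
      (fun hn => absurd (mem_verts he₀) hn)] at h1
  simpa using h1

open Classical in
/-- The moment condition at a vertex, obtained from test functions that vanish at all vertices and
whose slopes vanish away from the given vertex. -/
lemma IsWeakSolution.sum_moment {u v G : T.L2} (hu : T.InV u) (h : IsWeakSolution u v G)
    {a : V} {e₀ : E} (he₀ : e₀ ∈ T.incident a) {s : E → ℂ}
    (hext : T.IsExterior a → a ≠ T.root → s = 0)
    (hbalance : T.IsInterior a → ∑ e ∈ T.edgesAt .beam a, T.d a e * s e = 0) :
    ∑ e, T.d a e * (conj (T.moment u e a) * s e) = 0 := by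
  have h1 := h.sum_boundary hu (p := 0) (s := fun e b => if b = a then s e else 0) rfl
    (fun b hb hbr e _ _ => by
      split_ifs with hba
      · rw [hext (hba ▸ hb) (hba ▸ hbr)]; rfl
      · rfl)
    (fun b hb => by
      by_cases hba : b = a
      · subst hba
        simpa using hbalance hb
      · simp [hba])
  rw [Finset.sum_eq_single a (fun b _ hb => by simp [hb])
    (fun hn => absurd (mem_verts he₀) hn)] at h1
  simpa using h1

/-- A weak solution satisfies all the conditions that define the domain of the operator. -/
lemma IsWeakSolution.inDomain {u v G : T.L2} (hu : T.InV u) (hv : T.InV v)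
    (h : IsWeakSolution u v G) : T.InDomain u v := by
  classical
  have hfeed : ∀ a, T.IsExterior a → a ≠ T.root → ∀ e ∈ T.incident a,
      T.flux u e a = -(T.d a e * T.nodeVal 0 v e a) := by
    intro a ha har e he
    have huniq : ∀ e' ∈ T.incident a, e' = e := fun e' he' => ha.unique he' he
    have h1 := h.sum_flux hu he har
    rw [sum_d_mul_of_unique huniq (fun e => conj (T.flux u e a)), Finset.sum_eq_single e
      (fun e' _ hne => if_neg fun hc => hne (huniq e' hc.1))
      (fun h => absurd (Finset.mem_univ e) h), if_pos ⟨he, ha, har⟩] at h1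
    have h2 := congrArg conj h1
    simp only [map_mul, map_neg, conj_d, Complex.conj_conj] at h2
    linear_combination (T.d a e) * h2 - T.flux u e a * d_mul_d he
  have hmom : ∀ a, T.IsInterior a → ∀ e ∈ T.edgesAt .beam a, ∀ e' ∈ T.edgesAt .beam a,
      T.nodeVal 2 u e a = T.nodeVal 2 u e' a := by
    intro a ha e he e' he'
    by_cases hee : e = e'
    · rw [hee]
    -- opposite slopes on two beams keep the sum of the slopes equal to zero
    have hd := d_mul_d (T.mem_edgesAt.1 he).1
    have hd' := d_mul_d (T.mem_edgesAt.1 he').1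
    have h1 := h.sum_moment hu (T.mem_edgesAt.1 he).1
      (s := Pi.single e (T.d a e) - Pi.single e' (T.d a e'))
      (fun hext => absurd hext ha.not_isExterior) (fun _ => by
        simp only [Pi.sub_apply, mul_sub, Finset.sum_sub_distrib, Pi.single_apply, mul_ite, mul_zero,
          Finset.sum_ite_eq', if_pos he, if_pos he', hd, hd', sub_self])
    simp only [Pi.sub_apply, mul_sub, Finset.sum_sub_distrib, Pi.single_apply, mul_ite, mul_zero,
      Finset.sum_ite_eq', Finset.mem_univ, if_true, moment_beam (T.mem_edgesAt.1 he).2,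
      moment_beam (T.mem_edgesAt.1 he').2] at h1
    apply (starRingEnd ℂ).injective
    linear_combination h1 - conj (T.nodeVal 2 u e a) * hd + conj (T.nodeVal 2 u e' a) * hd'
  refine ⟨hu, hv, fun e => (h.regular hu e).1, ?_, ?_, hmom, ?_, ?_⟩
  · intro a ha har e he hk
    rw [← flux_string hk, hfeed a ha har e he]
  · intro e he hk
    have huniq : ∀ e' ∈ T.incident T.root, e' = e := fun e' he' => T.root_exterior.unique he' he
    have h1 := h.sum_moment hu he (s := fun _ => 1) (fun _ hr => absurd rfl hr)
      (fun hi => absurd rfl (root_not_isInterior hi))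
    rw [sum_d_mul_of_unique huniq (fun e => conj (T.moment u e T.root) * 1), moment_beam hk,
      mul_one] at h1
    apply (starRingEnd ℂ).injective
    rw [map_zero]
    linear_combination T.d T.root e * h1 - conj (T.nodeVal 2 u e T.root) * d_mul_d he
  · intro a ha har e he hk
    rw [← neg_inj, ← flux_beam hk, hfeed a ha har e he]
  · intro a ha
    obtain ⟨e₀, he₀, _⟩ := id ha
    have h1 := h.sum_flux hu he₀ (root_not_isInterior ha)
    rw [Finset.sum_eq_zero fun e _ => if_neg fun hc => ha.not_isExterior hc.2.1, neg_zero] at h1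
    have h2 : ∑ e, T.d a e * T.flux u e a = 0 := by
      apply (starRingEnd ℂ).injective
      rw [map_zero, ← h1, map_sum]
      exact Finset.sum_congr rfl fun e _ => by rw [map_mul, conj_d]
    rw [← h2, sum_d_mul, sub_eq_add_neg, ← Finset.sum_neg_distrib]
    congr 1
    · exact Finset.sum_congr rfl fun e he => by rw [flux_string (T.mem_edgesAt.1 he).2]
    · exact Finset.sum_congr rfl fun e he => by rw [flux_beam (T.mem_edgesAt.1 he).2, mul_neg]

/-! ### The operator is maximal dissipative -/

lemma mem_graph_operator {y z : T.EnergySpace} : (y, z) ∈ T.operator.graph ↔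
    T.InDomain y.disp y.vel ∧ z.disp = y.vel ∧ z.vel = T.elastic y.disp := by
  rw [LinearPMap.mem_graph_iff]
  constructor
  · rintro ⟨x, rfl, rfl⟩
    exact ⟨x.2, rfl, rfl⟩
  · rintro ⟨h, h1, h2⟩
    exact ⟨⟨y, h⟩, rfl, EnergySpace.ext h1.symm h2.symm⟩

lemma re_inner_operator_nonpos {y z : T.EnergySpace} (h : (y, z) ∈ T.operator.graph) :
    (inner ℂ z y).re ≤ 0 := by
  obtain ⟨hd, h1, h2⟩ := mem_graph_operator.1 h
  have h3 := congrArg Complex.re (hd.sum_eq hd.vel_mem)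
  have h4 : (inner ℂ z y).re = (∑ e, (inner ℂ (weakDeriv (T.kind e).order (y.disp e))
      (weakDeriv (T.kind e).order (y.vel e)) + inner ℂ (T.elastic y.disp e) (y.vel e))).re := by
    rw [inner_eq, energyInner, h1, h2, Finset.sum_add_distrib, Complex.add_re, Complex.add_re,
      add_left_inj, Complex.re_sum, Complex.re_sum]
    exact Finset.sum_congr rfl fun e _ => inner_re_symm (𝕜 := ℂ)
      (weakDeriv (T.kind e).order (y.vel e)) (weakDeriv (T.kind e).order (y.disp e))
  rw [h4, h3, Complex.neg_re, Complex.re_sum, neg_nonpos]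
  refine Finset.sum_nonneg fun p _ => ?_
  rw [mul_comm, Complex.mul_conj, Complex.ofReal_re]
  exact Complex.normSq_nonneg _

variable (T) in
open scoped ComplexOrder in
/-- Eliminating `v = c u - f` from the resolvent equation `c (u, v) - A (u, v) = (f, g)` leaves
`⟨u, w⟩_V + c² ∑ₑ ⟨u, w⟩ + c ∑ₐ ⟨u(a), w(a)⟩ = ∑ₑ ⟨c f + g, w⟩ + ∑ₐ ⟨f(a), w(a)⟩` for all `w`, where
`⟨u, w⟩_V` is the energy product and `a` runs over the vertices with feedback. The left side is a
positive perturbation of the energy product, so that the equation has a solution. -/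
lemma exists_resolvent_operator (c : ℝ) (hc : 0 < c) (z : T.EnergySpace) :
    ∃ y, (y, (c : ℂ) • y - z) ∈ T.operator.graph := by
  let P : T.EnergySpace →L[ℂ] T.EnergySpace :=
    ((c : ℂ) ^ 2) • ∑ e, (ContinuousLinearMap.adjoint (T.dispL e)).comp (T.dispL e) +
    (c : ℂ) • ∑ p ∈ T.feedback,
      (ContinuousLinearMap.adjoint (T.nodeValL p.1 p.2)).comp (T.nodeValL p.1 p.2)
  have hc0 : (0 : ℂ) ≤ c := Complex.zero_le_real.2 hc.le
  -- the equation is `(1 + P) y = r`; the velocity component of `y` plays no role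
  have hP : P.IsPositive := by
    refine .add (.smul_of_nonneg ?_ (pow_nonneg hc0 2)) (.smul_of_nonneg ?_ hc0)
    · rw [← ContinuousLinearMap.nonneg_iff_isPositive]
      refine Finset.sum_nonneg fun e _ => ?_
      rw [ContinuousLinearMap.nonneg_iff_isPositive]
      exact ContinuousLinearMap.isPositive_adjoint_comp_self _
    · rw [← ContinuousLinearMap.nonneg_iff_isPositive]
      refine Finset.sum_nonneg fun p _ => ?_
      rw [ContinuousLinearMap.nonneg_iff_isPositive]
      exact ContinuousLinearMap.isPositive_adjoint_comp_self _
  have hunit : IsUnit (1 + P) := by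
    refine CStarAlgebra.isUnit_of_le 1 ?_ isStrictlyPositive_one
    rw [← sub_nonneg, add_sub_cancel_left]
    exact (ContinuousLinearMap.nonneg_iff_isPositive P).2 hP
  obtain ⟨Q, hQ⟩ := hunit.exists_right_inv
  let r : T.EnergySpace :=
    ∑ e, ContinuousLinearMap.adjoint (T.dispL e) ((c : ℂ) • z.disp e + z.vel e) +
    ∑ p ∈ T.feedback, ContinuousLinearMap.adjoint (T.nodeValL p.1 p.2) (T.nodeValL p.1 p.2 z)
  set y := Q r with hy
  have hQr : y + P y = r := congrArg (fun L : T.EnergySpace →L[ℂ] T.EnergySpace => L r) hQ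
  have hPy : P y =
      ((c : ℂ) ^ 2) • ∑ e, ContinuousLinearMap.adjoint (T.dispL e) (T.dispL e y) +
      (c : ℂ) • ∑ p ∈ T.feedback,
        ContinuousLinearMap.adjoint (T.nodeValL p.1 p.2) (T.nodeValL p.1 p.2 y) := by
    simp [P]
  set v := ((c : ℂ) • y - z).disp with hv_def
  have hv : T.InV v := ((c : ℂ) • y - z).disp_mem
  have hnv : ∀ e a, T.nodeVal 0 v e a = c * T.nodeValL e a y - T.nodeValL e a z := fun e a => by
    rw [← smul_eq_mul, ← map_smul, ← map_sub]; rfl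
  have hve : ∀ e, v e = (c : ℂ) • T.dispL e y - z.disp e := fun e => by
    rw [← map_smul]; exact map_sub (T.dispL e) _ _
  have hweak : IsWeakSolution y.disp v ((c : ℂ) • v - z.vel) := by
    intro w hw
    set W := EnergySpace.mk w 0 hw with hW
    have h1 := congrArg (fun x => inner ℂ x W) hQr
    have hD : ∀ e, T.dispL e W = w e := fun _ => rfl
    have hN : ∀ e a, T.nodeValL e a W = T.nodeVal 0 w e a := fun _ _ => rfl
    have hyW : inner ℂ y W =
        ∑ e, inner ℂ (weakDeriv (T.kind e).order (y.disp e)) (weakDeriv (T.kind e).order (w e)) := by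
      rw [inner_eq, energyInner]
      simp [hW]
    simp only [hPy, r, inner_add_left, inner_smul_left, sum_inner,
      ContinuousLinearMap.adjoint_inner_left, hD, hN, hyW, RCLike.inner_apply', map_pow,
      Complex.conj_ofReal, Finset.sum_add_distrib, ← Finset.mul_sum] at h1
    simp only [Pi.sub_apply, Pi.smul_apply, hve, hnv, inner_sub_left, inner_smul_left, map_sub,
      map_mul, Complex.conj_ofReal, sub_mul, mul_assoc, mul_sub, Finset.sum_add_distrib,
      Finset.sum_sub_distrib, ← Finset.mul_sum]
    linear_combination h1
  refine ⟨EnergySpace.mk y.disp v y.disp_mem, mem_graph_operator.2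
    ⟨hweak.inDomain y.disp_mem hv, ?_, ?_⟩⟩
  · change (c : ℂ) • y.disp - z.disp = v
    rfl
  · funext e
    exact (hweak.regular y.disp_mem e).2.symm

variable (T) in
lemma isMaximalDissipative_operator : IsMaximalDissipative T.operator where
  re_inner_nonpos h := re_inner_operator_nonpos h
  exists_resolvent c hc z := T.exists_resolvent_operator c hc z

end Operator

end Network
end StringBeam
end

theorem mainTheorem5 {V E : Type*} [Fintype E] (T : StringBeam.Network V E) :
    CompleteSpace T.EnergySpace ∧
    (∃ S : ℝ≥0 → T.EnergySpace →L[ℂ] T.EnergySpace,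
      StringBeam.IsContractionSemigroup S ∧ StringBeam.IsGenerator T.operator S) ∧
    ∀ y₀ : T.EnergySpace, ∃ y : ℝ → T.EnergySpace,
      StringBeam.IsMildSolution T.operator y₀ y ∧
      (∀ z : ℝ → T.EnergySpace, StringBeam.IsMildSolution T.operator y₀ z → EqOn z y (Ici 0)) ∧
      (y₀ ∈ T.operator.domain → StringBeam.IsClassicalSolution T.operator y₀ y) := by
  have hA := T.isMaximalDissipative_operator
  exact ⟨inferInstance, ⟨hA.semigroup, hA.isContractionSemigroup, hA.isGenerator⟩, fun y₀ =>
    ⟨hA.orbit y₀, hA.isMildSolution y₀, fun z hz => hA.isMildSolution_unique (hA.isMildSolution y₀) hz,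
      fun h => hA.isClassicalSolution h⟩⟩
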